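/- For every integer $n \ge 6$ there exists a convex polyhedron $C$ in hyperbolic space $\mathbb{H}^3$ (a convex set with nonempty interior that is the intersection of a family of closed half-spaces whose bounding planes are locally finite) such that: 1. $C$ has infinite hyperbolic volume; 2. $C$ has at least one (two-dimensional) face, and every face of $C$ is a regular $n$-gon with right interior angles contained in a totally geodesic hyperbolic plane (that is, a convex $n$-gon all of whose sides have equal length and all of whose interior angles are $\pi/2$); 3. whenever two distinct faces of $C$ intersect, their intersection is a common side of both faces, and the dihedral angle of $C$ along this side is $\pi/2$; 4. at each vertex of $C$ exactly three faces and exactly three edges of $C$ meet. -/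

import Mathlib

noncomputable section

namespace Hyp3

/-- The Lorentzian bilinear form of signature `(3,1)` on `ℝ⁴`. -/
def lor (x y : Fin 4 → ℝ) : ℝ :=
  -(x 0 * y 0) + x 1 * y 1 + x 2 * y 2 + x 3 * y 3

/-- Hyperbolic 3-space, in the hyperboloid model, with the topology induced from `ℝ⁴`
(which is also the topology of the hyperbolic distance). -/
abbrev H3 : Type := {x : Fin 4 → ℝ // lor x x = -1 ∧ 0 < x 0}

/-- The hyperbolic distance. -/
def hdist (x y : H3) : ℝ := Real.arcosh (-lor x.1 y.1)

/-- The geodesic segment joining two points of hyperbolic space. -/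
def segment (x y : H3) : Set H3 :=
  {z | ∃ a b : ℝ, 0 ≤ a ∧ 0 ≤ b ∧ z.1 = a • x.1 + b • y.1}

/-- Geodesic convexity. -/
def IsConvex (K : Set H3) : Prop := ∀ x ∈ K, ∀ y ∈ K, segment x y ⊆ K

/-- The geodesic convex hull. -/
def hull (s : Set H3) : Set H3 := ⋂₀ {K | IsConvex K ∧ s ⊆ K}

/-- The orthogonal projection of `x` to the tangent space `p^⊥` of hyperbolic space at `p`; for
`x ≠ p` it is a positive multiple of the initial velocity of the geodesic from `p` to `x`. -/
def toward (p x : H3) : Fin 4 → ℝ := x.1 + lor x.1 p.1 • p.1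

/-- The angle at `p` between the geodesic segments from `p` to `x` and from `p` to `y`
(for `x ≠ p`, `y ≠ p`), measured in the tangent space at `p`, on which `lor` is the
Riemannian inner product. -/
def angle (x p y : H3) : ℝ :=
  Real.arccos (lor (toward p x) (toward p y) /
    (√(lor (toward p x) (toward p x)) * √(lor (toward p y) (toward p y))))

/-- Unit spacelike vectors. They parametrize the half-spaces of hyperbolic space. -/
abbrev Normal : Type := {u : Fin 4 → ℝ // lor u u = 1}

/-- The totally geodesic hyperbolic plane orthogonal to `u`. -/
def plane (u : Normal) : Set H3 := {x | lor x.1 u.1 = 0}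

/-- The closed half-space bounded by `plane u` with outward unit normal `u`. -/
def halfSpace (u : Normal) : Set H3 := {x | lor x.1 u.1 ≤ 0}

/-- The interior dihedral angle of `halfSpace u ∩ halfSpace v` along the line
`plane u ∩ plane v` (when these planes cross): at every point of this line, `u` and `v` are tangent
vectors, namely the outward unit normals, and the dihedral angle is `π` minus their angle. -/
def dihedralAngle (u v : Normal) : ℝ := Real.pi - Real.arccos (lor u.1 v.1)

/-- A (three-dimensional) convex polyhedron: a convex set with nonempty interior that is the
intersection of a family of closed half-spaces whose bounding planes are locally finite. -/
structure IsConvexPolyhedron (C : Set H3) : Prop where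
  convex : IsConvex C
  interior_nonempty : (interior C).Nonempty
  halfSpaces : ∃ S : Set Normal,
    LocallyFinite (fun u : S => plane u.1) ∧ C = ⋂ u ∈ S, halfSpace u

/-- `F` is the part of `K` cut out by the plane with normal `u`, which supports `K`, and `F` has
dimension `k`. (A convex set has dimension `k` if the smallest totally geodesic subspace containing
it, which is the trace of its linear span, has dimension `k`.) -/
def IsFaceWithNormal (k : ℕ) (K F : Set H3) (u : Normal) : Prop :=
  K ⊆ halfSpace u ∧ F = K ∩ plane u ∧
    Module.finrank ℝ (Submodule.span ℝ ((fun x : H3 => x.1) '' F)) = k + 1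

/-- `F` is a `k`-dimensional face of the convex set `K`. For a polyhedron these are its vertices
(`k = 0`), edges (`k = 1`) and faces in the usual sense (`k = 2`); for a convex polygon
`k = 0` gives its vertices and `k = 1` its sides. -/
def IsFace (k : ℕ) (K F : Set H3) : Prop := ∃ u : Normal, IsFaceWithNormal k K F u

/-- `F` is a regular `n`-gon with right interior angles lying in a plane: it is the convex hull of
`n` distinct points of a plane, the segments joining cyclically consecutive points are sides
of `F`, all these sides have the same length, and all interior angles are `π / 2`. -/
def IsRegularRightAngledPolygon (n : ℕ) (F : Set H3) : Prop :=
  (∃ u : Normal, F ⊆ plane u) ∧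
  ∃ v : ZMod n → H3, Function.Injective v ∧ F = hull (Set.range v) ∧
    (∀ i, IsFace 1 F (segment (v i) (v (i + 1)))) ∧
    (∃ r : ℝ, ∀ i, hdist (v i) (v (i + 1)) = r) ∧
    ∀ i, angle (v (i - 1)) (v i) (v (i + 1)) = Real.pi / 2

theorem lift_mem (y : Fin 3 → ℝ) :
    lor ![√(1 + y 0 ^ 2 + y 1 ^ 2 + y 2 ^ 2), y 0, y 1, y 2]
        ![√(1 + y 0 ^ 2 + y 1 ^ 2 + y 2 ^ 2), y 0, y 1, y 2] = -1 ∧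
      0 < ![√(1 + y 0 ^ 2 + y 1 ^ 2 + y 2 ^ 2), y 0, y 1, y 2] 0 := by
  have h : 0 < 1 + y 0 ^ 2 + y 1 ^ 2 + y 2 ^ 2 := by positivity
  refine ⟨?_, by simpa using Real.sqrt_pos.2 h⟩
  simp only [lor, Matrix.cons_val]
  rw [Real.mul_self_sqrt h.le]
  ring

/-- The global parametrization of the hyperboloid as a graph over `ℝ³`. -/
def lift (y : Fin 3 → ℝ) : H3 :=
  ⟨![√(1 + y 0 ^ 2 + y 1 ^ 2 + y 2 ^ 2), y 0, y 1, y 2], lift_mem y⟩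

/-- The hyperbolic volume: in the graph parametrization of the hyperboloid the Riemannian volume
element is `dy₁ dy₂ dy₃ / √(1 + |y|²)`. -/
def hypVolume : MeasureTheory.Measure H3 :=
  ((MeasureTheory.volume : MeasureTheory.Measure (Fin 3 → ℝ)).withDensity
    (fun y => ENNReal.ofReal (1 / √(1 + y 0 ^ 2 + y 1 ^ 2 + y 2 ^ 2)))).map lift

end Hyp3

end

/-!
Take the regular right-angled `n`-gon in a plane of `ℍ³` and build the reflection group generated by
the two reflections in its symmetry axes that bound a fundamental triangle and by the reflection
exchanging its plane with the orthogonal plane through one of its sides. Their mirrors meet at the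
angles `π / n`, `π / 2` and `π / 3`, so this is the symmetry group of the tiling by `n`-gons with
three around each vertex; acting on `ℍ³` it fixes a vector which for `n = 6` is null and for `n > 6`
spacelike. The polyhedron is the intersection of the half-spaces bounded by the images of the plane
of the `n`-gon.

By descent on the word length in the Coxeter group, every image normal is the normal of the plane
of the initial `n`-gon, the normal of one of its neighbours, or has third coordinate at most `-1`.
Hence any two of the planes are orthogonal or have disjoint half-space complements, and the local
combinatorics and the dihedral angles are linear algebra with orthonormal families of normals. For
`n ≥ 6` every image normal `u` other than that of the initial `n`-gon satisfies `u 0 + u 3 ≥ 1`, so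
the polyhedron contains the horoball centred at `(1, 0, 0, -1)` that is tangent to the initial
`n`-gon at its centre, and a horoball has infinite volume.
-/

noncomputable section

namespace Hyp3

open scoped Pointwise

/-! ### Coxeter groups acting on their roots -/

section Coxeter

open CoxeterSystem

variable {B W : Type*} [Group W] {M : CoxeterMatrix B} (cs : CoxeterSystem M W)

theorem length_mul_alternatingWord_le (v : W) (i j : B) (m : ℕ) :
    cs.length (v * cs.wordProd (alternatingWord i j m)) ≤ cs.length v + m := by
  have hword := cs.length_wordProd_le (alternatingWord i j m)
  rw [length_alternatingWord] at hword
  exact (cs.length_mul_le _ _).trans (by gcongr)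

theorem mul_alternatingWord_succ_mul_simple (v : W) (i j : B) (m : ℕ) :
    v * cs.wordProd (alternatingWord j i (m + 1)) * cs.simple i =
      v * cs.wordProd (alternatingWord i j m) := by
  rw [alternatingWord_succ, wordProd_concat, ← mul_assoc, simple_mul_simple_cancel_right]

theorem eq_mul_alternatingWord_succ {i j : B} {v w : W} {m : ℕ} (hi : cs.IsRightDescent w i)
    (hlen : cs.length (w * cs.simple i) = cs.length v + m)
    (hw : w * cs.simple i = v * cs.wordProd (alternatingWord i j m) ∨
      w * cs.simple i = v * cs.wordProd (alternatingWord j i m)) :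
    w = v * cs.wordProd (alternatingWord j i (m + 1)) := by
  have hlen_w := cs.isRightDescent_iff.1 hi
  apply mul_right_cancel (b := cs.simple i)
  rw [mul_alternatingWord_succ_mul_simple]
  rcases hw with hw | hw
  · exact hw
  cases m with
  | zero => exact hw
  | succ m =>
    have hw' : w = v * cs.wordProd (alternatingWord i j m) := by
      rw [← mul_alternatingWord_succ_mul_simple, ← hw, simple_mul_simple_cancel_right]
    have := length_mul_alternatingWord_le cs v i j m
    rw [← hw'] at this
    omega

theorem exists_eq_mul_alternatingWord (i j : B) (w : W) :
    ∃ v : W, ∃ m : ℕ, ¬ cs.IsRightDescent v i ∧ ¬ cs.IsRightDescent v j ∧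
      cs.length w = cs.length v + m ∧
      (w = v * cs.wordProd (alternatingWord i j m) ∨
        w = v * cs.wordProd (alternatingWord j i m)) := by
  induction hk : cs.length w using Nat.strong_induction_on generalizing w with
  | _ k ih =>
    subst hk
    by_cases hi : cs.IsRightDescent w i
    · obtain ⟨v, m, hvi, hvj, hlen, h⟩ := ih _ hi _ rfl
      have hlen_w := cs.isRightDescent_iff.1 hi
      exact ⟨v, m + 1, hvi, hvj, by omega, .inr (eq_mul_alternatingWord_succ cs hi hlen h)⟩
    by_cases hj : cs.IsRightDescent w j
    · obtain ⟨v, m, hvi, hvj, hlen, h⟩ := ih _ hj _ rfl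
      have hlen_w := cs.isRightDescent_iff.1 hj
      exact ⟨v, m + 1, hvi, hvj, by omega, .inl (eq_mul_alternatingWord_succ cs hj hlen h.symm)⟩
    · exact ⟨w, 0, hi, hj, rfl, .inl (mul_one w).symm⟩

theorem exists_eq_mul_alternatingWord_of_not_isRightDescent {i j : B} (hM : M i j ≠ 0) {w : W}
    (hi : ¬ cs.IsRightDescent w i) :
    ∃ v : W, ∃ m < M i j, ¬ cs.IsRightDescent v i ∧ ¬ cs.IsRightDescent v j ∧
      cs.length w = cs.length v + m ∧ w = v * cs.wordProd (alternatingWord i j m) := by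
  obtain ⟨v, m, hvi, hvj, hlen, hw⟩ := exists_eq_mul_alternatingWord cs i j w
  have hm : w = v * cs.wordProd (alternatingWord j i m) → m = 0 := by
    rintro rfl
    cases m with
    | zero => rfl
    | succ m =>
      have := length_mul_alternatingWord_le cs v i j m
      rw [IsRightDescent, mul_alternatingWord_succ_mul_simple] at hi
      omega
  have hw : w = v * cs.wordProd (alternatingWord i j m) :=
    hw.elim id fun h => by rw [h, hm h]; rfl
  have hreduced : cs.IsReduced (alternatingWord i j m) := by
    have hmul := cs.length_mul_le v (cs.wordProd (alternatingWord i j m))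
    have hword := cs.length_wordProd_le (alternatingWord i j m)
    rw [← hw] at hmul
    rw [length_alternatingWord] at hword
    rw [CoxeterSystem.IsReduced, length_alternatingWord]
    omega
  refine ⟨v, m, ?_, hvi, hvj, hlen, hw⟩
  have hle := not_lt.1 fun hlt => cs.not_isReduced_alternatingWord i j hM hlt hreduced
  refine hle.lt_of_ne fun heq => hM ?_
  have hbraid := cs.wordProd_braidWord_eq i j
  rw [braidWord, braidWord, M.symmetric j i, ← heq] at hbraid
  rw [← heq, hm (hbraid ▸ hw)]

variable {V : Type*} [AddCommGroup V] [Module ℝ V]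

/-- Along the representation `ρ` the Coxeter group acts on the family `a` as on the simple roots of
its geometric representation: the generator `i` is the reflection along `a i` for a bilinear form
with Gram matrix `-cos (π / M i j)`. For `i = j` the formula reads `a i ↦ -a i`. -/
def ActsAsOnSimpleRoots (ρ : W →* Module.End ℝ V) (a : B → V) : Prop :=
  ∀ i j, ρ (cs.simple i) (a j) = a j + (2 * Real.cos (Real.pi / M i j)) • a i

theorem sin_add_two_mul (m : ℕ) (θ : ℝ) :
    Real.sin (((m + 2 : ℕ) : ℝ) * θ) =
      2 * Real.cos θ * Real.sin (((m + 1 : ℕ) : ℝ) * θ) - Real.sin (m * θ) := by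
  have hsub : (m : ℝ) * θ = ((m + 1 : ℕ) : ℝ) * θ - θ := by push_cast; ring
  have hadd : ((m + 2 : ℕ) : ℝ) * θ = ((m + 1 : ℕ) : ℝ) * θ + θ := by push_cast; ring
  rw [hsub, hadd, Real.sin_sub, Real.sin_add]
  ring

variable {cs} {ρ : W →* Module.End ℝ V} {a : B → V} (h : ActsAsOnSimpleRoots cs ρ a)
include h

theorem ActsAsOnSimpleRoots.simple_apply_self (i : B) : ρ (cs.simple i) (a i) = -a i := by
  rw [h i i, M.diagonal, Nat.cast_one, div_one, Real.cos_pi]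
  module

theorem ActsAsOnSimpleRoots.sin_smul_alternatingWord_apply (i j : B) (m : ℕ) :
    Real.sin (Real.pi / M i j) • ρ (cs.wordProd (alternatingWord i j m)) (a i) =
      if Even m then
        Real.sin ((m + 1 : ℕ) * (Real.pi / M i j)) • a i + Real.sin (m * (Real.pi / M i j)) • a j
      else
        Real.sin ((m + 1 : ℕ) * (Real.pi / M i j)) • a j +
          Real.sin (m * (Real.pi / M i j)) • a i := by
  induction m with
  | zero => simp [alternatingWord]
  | succ m ih =>
    rw [alternatingWord_succ', wordProd_cons, map_mul, Module.End.mul_apply, ← map_smul, ih]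
    by_cases hm : Even m
    · rw [if_pos hm, if_pos hm, if_neg (by simpa [Nat.even_add_one] using hm), map_add, map_smul,
        map_smul, h.simple_apply_self, h j i, M.symmetric j i, sin_add_two_mul]
      module
    · rw [if_neg hm, if_neg hm, if_pos (by simpa [Nat.even_add_one] using hm), map_add, map_smul,
        map_smul, h.simple_apply_self, h i j, sin_add_two_mul]
      module

theorem ActsAsOnSimpleRoots.map_mul_alternatingWord_nonpos {f : V →ₗ[ℝ] ℝ} {i j : B} {v : W}
    {m : ℕ} (hm : m < M i j) (hi : f (ρ v (a i)) ≤ 0) (hj : f (ρ v (a j)) ≤ 0) :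
    f (ρ (v * cs.wordProd (alternatingWord i j m)) (a i)) ≤ 0 := by
  have hM : (0 : ℝ) < M i j := by exact_mod_cast hm.pos
  have hsin_nonneg : ∀ k : ℕ, k ≤ M i j → 0 ≤ Real.sin (k * (Real.pi / M i j)) := by
    intro k hk
    apply Real.sin_nonneg_of_nonneg_of_le_pi (by positivity)
    rw [mul_div_assoc', div_le_iff₀ hM, mul_comm]
    gcongr
  have hcomb : Real.sin (Real.pi / M i j) *
      f (ρ (v * cs.wordProd (alternatingWord i j m)) (a i)) ≤ 0 := by
    rw [map_mul, Module.End.mul_apply, ← smul_eq_mul, ← map_smul, ← map_smul,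
      h.sin_smul_alternatingWord_apply]
    have hm0 := hsin_nonneg m hm.le
    have hm1 := hsin_nonneg (m + 1) hm
    split_ifs <;> simp only [map_add, map_smul, smul_eq_mul] <;>
      exact add_nonpos (mul_nonpos_of_nonneg_of_nonpos hm1 ‹_›)
        (mul_nonpos_of_nonneg_of_nonpos hm0 ‹_›)
  rcases eq_or_ne m 0 with rfl | hm0
  · simpa [alternatingWord] using hi
  refine nonpos_of_mul_nonpos_right hcomb (Real.sin_pos_of_pos_of_lt_pi (by positivity) ?_)
  exact div_lt_self Real.pi_pos (by exact_mod_cast (by omega : 1 < M i j))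

/-- Factor `w` through the dihedral subgroup generated by `i` and a right descent `j`: the root
`w • a i` is a nonnegative combination of two roots of shorter elements. -/
theorem ActsAsOnSimpleRoots.map_nonpos_of_not_isRightDescent (hM : ∀ i j, M i j ≠ 0)
    {f : V →ₗ[ℝ] ℝ} (hf : ∀ i, f (a i) ≤ 0) {w : W} {i : B} (hw : ¬ cs.IsRightDescent w i) :
    f (ρ w (a i)) ≤ 0 := by
  induction hk : cs.length w using Nat.strong_induction_on generalizing w i with
  | _ k ih =>
    subst hk
    rcases eq_or_ne w 1 with rfl | hw1
    · simpa using hf i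
    obtain ⟨j, hj⟩ := cs.exists_rightDescent_of_ne_one hw1
    obtain ⟨v, m, hm, hvi, hvj, hlen, rfl⟩ :=
      exists_eq_mul_alternatingWord_of_not_isRightDescent cs (hM i j) hw
    have hm0 : m ≠ 0 := by
      rintro rfl
      exact hvj (by simpa [alternatingWord] using hj)
    exact h.map_mul_alternatingWord_nonpos hm (ih _ (by omega) hvi rfl) (ih _ (by omega) hvj rfl)

end Coxeter

/-! ### The Lorentzian form -/

/-- `lor` as a bilinear form, giving access to the library on orthogonality. -/
def lorForm : LinearMap.BilinForm ℝ (Fin 4 → ℝ) :=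
  LinearMap.mk₂ ℝ lor (by intros; simp [lor]; ring) (by intros; simp [lor]; ring)
    (by intros; simp [lor]; ring) (by intros; simp [lor]; ring)

theorem lor_comm (x y : Fin 4 → ℝ) : lor x y = lor y x := by simp only [lor]; ring

@[simp] theorem lor_add_left (x y z : Fin 4 → ℝ) : lor (x + y) z = lor x z + lor y z :=
  LinearMap.map_add₂ lorForm x y z

@[simp] theorem lor_add_right (x y z : Fin 4 → ℝ) : lor x (y + z) = lor x y + lor x z :=
  map_add (lorForm x) y z

@[simp] theorem lor_sub_left (x y z : Fin 4 → ℝ) : lor (x - y) z = lor x z - lor y z :=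
  LinearMap.map_sub₂ lorForm x y z

@[simp] theorem lor_sub_right (x y z : Fin 4 → ℝ) : lor x (y - z) = lor x y - lor x z :=
  map_sub (lorForm x) y z

@[simp] theorem lor_smul_left (r : ℝ) (x y : Fin 4 → ℝ) : lor (r • x) y = r * lor x y :=
  LinearMap.map_smul₂ lorForm r x y

@[simp] theorem lor_smul_right (r : ℝ) (x y : Fin 4 → ℝ) : lor x (r • y) = r * lor x y :=
  map_smul (lorForm x) r y

@[simp] theorem lor_neg_left (x y : Fin 4 → ℝ) : lor (-x) y = -lor x y :=
  LinearMap.map_neg₂ lorForm x y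

@[simp] theorem lor_neg_right (x y : Fin 4 → ℝ) : lor x (-y) = -lor x y :=
  map_neg (lorForm x) y

@[simp] theorem lor_zero_left (x : Fin 4 → ℝ) : lor 0 x = 0 := LinearMap.map_zero₂ lorForm x

theorem lor_sum_left {ι : Type*} (s : Finset ι) (f : ι → Fin 4 → ℝ) (y : Fin 4 → ℝ) :
    lor (∑ i ∈ s, f i) y = ∑ i ∈ s, lor (f i) y :=
  LinearMap.map_sum₂ lorForm s f y

theorem lor_eq_zero_of_mem_span {s : Set (Fin 4 → ℝ)} {x t : Fin 4 → ℝ}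
    (hx : x ∈ Submodule.span ℝ s) (h : ∀ y ∈ s, lor y t = 0) : lor x t = 0 := by
  have hle : Submodule.span ℝ s ≤ LinearMap.ker (lorForm t) :=
    Submodule.span_le.2 fun y hy => (lor_comm t y).trans (h y hy)
  exact (lor_comm x t).trans (hle hx)

theorem eq_zero_of_forall_lor_eq_zero {x : Fin 4 → ℝ} (h : ∀ y, lor x y = 0) : x = 0 := by
  have h0 := h ![1, 0, 0, 0]
  have h1 := h ![0, 1, 0, 0]
  have h2 := h ![0, 0, 1, 0]
  have h3 := h ![0, 0, 0, 1]
  simp only [lor, Matrix.cons_val, mul_one, mul_zero, add_zero, zero_add, neg_zero, neg_eq_zero]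
    at h0 h1 h2 h3
  ext i
  fin_cases i <;> assumption

theorem lorForm_nondegenerate : lorForm.Nondegenerate :=
  ⟨fun _ h => eq_zero_of_forall_lor_eq_zero h,
    fun x h => eq_zero_of_forall_lor_eq_zero fun y => (lor_comm x y).trans (h y)⟩

theorem lorForm_isRefl : lorForm.IsRefl := fun x y h => (lor_comm y x).trans h

theorem exists_ne_zero_forall_lor_eq_zero {S : Submodule ℝ (Fin 4 → ℝ)}
    (hS : Module.finrank ℝ S < 4) : ∃ t : Fin 4 → ℝ, t ≠ 0 ∧ ∀ x ∈ S, lor x t = 0 := by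
  have hfinrank := LinearMap.BilinForm.finrank_orthogonal lorForm_nondegenerate S
  rw [Module.finrank_fin_fun] at hfinrank
  obtain ⟨t, ht, ht0⟩ := Submodule.exists_mem_ne_zero_of_ne_bot
    (p := lorForm.orthogonal S) (fun hbot => by rw [hbot, finrank_bot] at hfinrank; omega)
  exact ⟨t, ht0, fun x hx => LinearMap.BilinForm.mem_orthogonal_iff.1 ht x hx⟩

theorem lor_self_add_sq (x : Fin 4 → ℝ) : lor x x + x 0 ^ 2 = x 1 ^ 2 + x 2 ^ 2 + x 3 ^ 2 := by
  simp only [lor]; ring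

theorem lor_add_mul_sq_le (x y : Fin 4 → ℝ) :
    (lor x y + x 0 * y 0) ^ 2 ≤ (lor x x + x 0 ^ 2) * (lor y y + y 0 ^ 2) := by
  have hcs := Finset.sum_mul_sq_le_sq_mul_sq Finset.univ
    (fun i : Fin 3 => x i.succ) fun i => y i.succ
  simp only [Fin.sum_univ_three, Fin.succ_zero_eq_one, Fin.succ_one_eq_two,
    show (2 : Fin 3).succ = 3 from rfl] at hcs
  rwa [lor_self_add_sq, lor_self_add_sq,
    show lor x y + x 0 * y 0 = x 1 * y 1 + x 2 * y 2 + x 3 * y 3 by simp only [lor]; ring]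

theorem lor_self_pos_of_lor_eq_zero {x t : Fin 4 → ℝ} (hx : lor x x < 0) (h : lor t x = 0)
    (ht : t ≠ 0) : 0 < lor t t := by
  by_contra! hle
  have hcs := lor_add_mul_sq_le t x
  have ht_sq := lor_self_add_sq t
  have hx_sq := lor_self_add_sq x
  rw [h, zero_add, mul_pow] at hcs
  have ht0 : t 0 ^ 2 ≤ 0 := by
    nlinarith [sq_nonneg (x 1), sq_nonneg (x 2), sq_nonneg (x 3)]
  have h0 : t 0 = 0 := pow_eq_zero_iff two_ne_zero |>.1 (ht0.antisymm (sq_nonneg _))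
  apply ht
  ext i
  fin_cases i
  · exact h0
  all_goals
    simp only [Pi.zero_apply, Fin.mk_one, Fin.reduceFinMk]
    nlinarith [sq_nonneg (t 1), sq_nonneg (t 2), sq_nonneg (t 3)]

theorem lor_self_nonneg_of_lor_eq_zero {x t : Fin 4 → ℝ} (hx : lor x x < 0) (h : lor t x = 0) :
    0 ≤ lor t t := by
  rcases eq_or_ne t 0 with rfl | ht
  · simp
  · exact (lor_self_pos_of_lor_eq_zero hx h ht).le

theorem lor_neg_of_timelike_of_causal {x y : Fin 4 → ℝ} (hx : lor x x < 0) (hx0 : 0 < x 0)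
    (hy : lor y y ≤ 0) (hy0 : 0 < y 0) : lor x y < 0 := by
  have hx_nonneg : 0 ≤ lor x x + x 0 ^ 2 := by rw [lor_self_add_sq]; positivity
  have hlt : (lor x y + x 0 * y 0) ^ 2 < (x 0 * y 0) ^ 2 := by
    calc (lor x y + x 0 * y 0) ^ 2
        ≤ (lor x x + x 0 ^ 2) * (lor y y + y 0 ^ 2) := lor_add_mul_sq_le x y
      _ ≤ (lor x x + x 0 ^ 2) * y 0 ^ 2 := by gcongr; linarith
      _ < x 0 ^ 2 * y 0 ^ 2 := by gcongr; linarith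
      _ = (x 0 * y 0) ^ 2 := (mul_pow _ _ _).symm
  linarith [lt_of_pow_lt_pow_left₀ 2 (by positivity) hlt]

theorem H3.lor_neg (x y : H3) : lor x.1 y.1 < 0 :=
  lor_neg_of_timelike_of_causal (by simp [x.2.1]) x.2.2 (by simp [y.2.1]) y.2.2

theorem H3.ne_zero (x : H3) : x.1 ≠ 0 := fun h => x.2.2.ne' (congrFun h 0)

theorem pos_zero_of_lor_neg (x : H3) {y : Fin 4 → ℝ} (hy : lor y y < 0) (h : lor y x.1 < 0) :
    0 < y 0 := by
  rcases lt_trichotomy 0 (y 0) with hpos | hzero | hneg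
  · exact hpos
  · have := lor_self_add_sq y
    rw [← hzero] at this
    nlinarith [sq_nonneg (y 1), sq_nonneg (y 2), sq_nonneg (y 3)]
  · have := lor_neg_of_timelike_of_causal (x := -y) (by simpa) (by simpa) (by simp [x.2.1]) x.2.2
    rw [lor_neg_left] at this
    linarith

theorem H3.eq_of_eq_smul {x y : H3} {r : ℝ} (h : x.1 = r • y.1) : x = y := by
  have hx := x.2
  rw [h, lor_smul_left, lor_smul_right, y.2.1, Pi.smul_apply, smul_eq_mul] at hx
  have hr : 0 < r := pos_of_mul_pos_left hx.2 y.2.2.le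
  have hr1 : r = 1 := by nlinarith
  exact Subtype.ext (by rw [h, hr1, one_smul])

theorem exists_eq_smul_of_timelike {y : Fin 4 → ℝ} (hy : lor y y < 0) (hy0 : 0 < y 0) :
    ∃ r : ℝ, 0 < r ∧ ∃ x : H3, y = r • x.1 := by
  have hr : 0 < √(-lor y y) := Real.sqrt_pos.2 (by linarith)
  have hr2 : √(-lor y y) ^ 2 = -lor y y := Real.sq_sqrt (by linarith)
  refine ⟨√(-lor y y), hr, ⟨(√(-lor y y))⁻¹ • y, ?_, ?_⟩, ?_⟩
  · rw [lor_smul_left, lor_smul_right]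
    field_simp
    linarith
  · simpa using mul_pos (inv_pos.2 hr) hy0
  · rw [smul_smul, mul_inv_cancel₀ hr.ne', one_smul]

/-! ### Convex sets and their cones -/

/-- The linear span of a set of points of hyperbolic space. Its trace on hyperbolic space is the
smallest totally geodesic subspace containing the set. -/
abbrev linearSpan (s : Set H3) : Submodule ℝ (Fin 4 → ℝ) :=
  Submodule.span ℝ ((fun x : H3 => x.1) '' s)

theorem mem_linearSpan {s : Set H3} {x : H3} (hx : x ∈ s) : x.1 ∈ linearSpan s :=
  Submodule.subset_span ⟨x, hx, rfl⟩

theorem lor_eq_zero_of_mem_linearSpan {s : Set H3} {u : Normal} (hs : s ⊆ plane u)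
    {x : Fin 4 → ℝ} (hx : x ∈ linearSpan s) : lor x u.1 = 0 :=
  lor_eq_zero_of_mem_span hx (by rintro _ ⟨y, hy, rfl⟩; exact hs hy)

theorem linearSpan_segment (x y : H3) : linearSpan (segment x y) = Submodule.span ℝ {x.1, y.1} := by
  refine le_antisymm (Submodule.span_le.2 ?_) (Submodule.span_le.2 ?_)
  · rintro _ ⟨z, ⟨a, b, -, -, hz⟩, rfl⟩
    exact Submodule.mem_span_pair.2 ⟨a, b, hz.symm⟩
  · rintro _ (rfl | rfl)
    · exact mem_linearSpan ⟨1, 0, zero_le_one, le_rfl, by simp⟩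
    · exact mem_linearSpan ⟨0, 1, le_rfl, zero_le_one, by simp⟩

theorem finrank_linearSpan_segment {x y : H3} (h : x ≠ y) :
    Module.finrank ℝ (linearSpan (segment x y)) = 2 := by
  have hind : LinearIndependent ℝ ![x.1, y.1] :=
    (LinearIndependent.pair_iff' x.ne_zero).2 fun r hr => h (H3.eq_of_eq_smul hr.symm).symm
  rw [linearSpan_segment, ← Matrix.range_cons_cons_empty _ _ ![], finrank_span_eq_card hind,
    Fintype.card_fin]

theorem linearSpan_singleton (x : H3) : linearSpan {x} = Submodule.span ℝ {x.1} := by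
  rw [linearSpan, Set.image_singleton]

/-- The union of the open rays from the origin of `ℝ⁴` through a set of points of hyperbolic space.
Geodesic convexity of the set amounts to convexity of this cone. -/
def cone (K : Set H3) : Set (Fin 4 → ℝ) := {y | ∃ r : ℝ, 0 < r ∧ ∃ x ∈ K, y = r • x.1}

theorem mem_cone_of_mem {K : Set H3} {x : H3} (hx : x ∈ K) : x.1 ∈ cone K :=
  ⟨1, one_pos, x, hx, (one_smul _ _).symm⟩

theorem mem_of_mem_cone {K : Set H3} {x : H3} (hx : x.1 ∈ cone K) : x ∈ K := by
  obtain ⟨r, -, y, hy, h⟩ := hx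
  rwa [H3.eq_of_eq_smul h]

theorem smul_mem_cone {K : Set H3} {y : Fin 4 → ℝ} (hy : y ∈ cone K) {r : ℝ} (hr : 0 < r) :
    r • y ∈ cone K := by
  obtain ⟨a, ha, x, hx, rfl⟩ := hy
  exact ⟨r * a, by positivity, x, hx, smul_smul _ _ _⟩

theorem IsConvex.add_mem_cone {K : Set H3} (hK : IsConvex K) {y z : Fin 4 → ℝ}
    (hy : y ∈ cone K) (hz : z ∈ cone K) : y + z ∈ cone K := by
  obtain ⟨a, ha, x, hx, rfl⟩ := hy
  obtain ⟨b, hb, x', hx', rfl⟩ := hz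
  have htimelike : lor (a • x.1 + b • x'.1) (a • x.1 + b • x'.1) < 0 := by
    simp only [lor_add_left, lor_add_right, lor_smul_left, lor_smul_right, x.2.1, x'.2.1,
      lor_comm x'.1 x.1]
    nlinarith [x.lor_neg x', mul_pos ha hb, mul_pos ha ha, mul_pos hb hb]
  have hfuture : 0 < (a • x.1 + b • x'.1) 0 := by
    simpa using add_pos (mul_pos ha x.2.2) (mul_pos hb x'.2.2)
  obtain ⟨r, hr, p, hp⟩ := exists_eq_smul_of_timelike htimelike hfuture
  refine ⟨r, hr, p, hK x hx x' hx' ⟨r⁻¹ * a, r⁻¹ * b, by positivity, by positivity, ?_⟩, hp⟩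
  rw [mul_smul, mul_smul, ← smul_add, hp, smul_smul, inv_mul_cancel₀ hr.ne', one_smul]

theorem IsConvex.sum_mem_cone {K : Set H3} (hK : IsConvex K) {ι : Type*} {s : Finset ι}
    (hs : s.Nonempty) {f : ι → Fin 4 → ℝ} (hf : ∀ i ∈ s, f i ∈ cone K) :
    ∑ i ∈ s, f i ∈ cone K :=
  Finset.sum_induction_nonempty f (· ∈ cone K) (fun _ _ => hK.add_mem_cone) hs hf

theorem isConvex_halfSpace (u : Normal) : IsConvex (halfSpace u) := by
  rintro x hx y hy z ⟨a, b, ha, hb, hz⟩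
  simp only [halfSpace, Set.mem_ofPred_eq] at hx hy ⊢
  rw [hz, lor_add_left, lor_smul_left, lor_smul_left]
  nlinarith

theorem isConvex_plane (u : Normal) : IsConvex (plane u) := by
  rintro x hx y hy z ⟨a, b, -, -, hz⟩
  simp only [plane, Set.mem_ofPred_eq] at hx hy ⊢
  rw [hz, lor_add_left, lor_smul_left, lor_smul_left, hx, hy, mul_zero, mul_zero, add_zero]

theorem IsConvex.inter {K L : Set H3} (hK : IsConvex K) (hL : IsConvex L) : IsConvex (K ∩ L) :=
  fun x hx y hy _ hz => ⟨hK x hx.1 y hy.1 hz, hL x hx.2 y hy.2 hz⟩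

/-- The sum of a basis of `linearSpan K` consisting of points of `K` is relatively interior. -/
theorem IsConvex.exists_mem_forall_subset_plane {K : Set H3} (hK : IsConvex K) (hne : K.Nonempty) :
    ∃ x ∈ K, ∀ u : Normal, K ⊆ halfSpace u → x ∈ plane u → K ⊆ plane u := by
  obtain ⟨f, hf, hspan, -⟩ := Submodule.exists_fun_fin_finrank_span_eq ℝ ((fun x : H3 => x.1) '' K)
  choose g hgK hg using hf
  have hindex : Nonempty (Fin (Module.finrank ℝ (linearSpan K))) := by
    by_contra! hempty
    obtain ⟨x, hx⟩ := hne
    have hbot : x.1 ∈ (⊥ : Submodule ℝ (Fin 4 → ℝ)) := by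
      rw [← Submodule.span_empty, ← Set.range_eq_empty f, hspan]
      exact mem_linearSpan hx
    exact x.ne_zero hbot
  obtain ⟨r, -, x, hx, hsum⟩ := hK.sum_mem_cone (s := Finset.univ) Finset.univ_nonempty
    (f := fun i => (g i).1) fun i _ => mem_cone_of_mem (hgK i)
  refine ⟨x, hx, fun u hu hxu => ?_⟩
  have hsum_zero : ∑ i, lor (g i).1 u.1 = 0 := by
    rw [← lor_sum_left, hsum, lor_smul_left, show lor x.1 u.1 = 0 from hxu, mul_zero]
  have hzero := (Finset.sum_eq_zero_iff_of_nonpos fun i _ => hu (hgK i)).1 hsum_zero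
  intro y hy
  have hy' : y.1 ∈ Submodule.span ℝ (Set.range f) := by
    rw [hspan]
    exact mem_linearSpan hy
  refine lor_eq_zero_of_mem_span hy' ?_
  rintro _ ⟨i, rfl⟩
  rw [← hg i]
  exact hzero i (Finset.mem_univ i)

/-! ### Isometries -/

section Isometries

/-- The isometry group of hyperbolic space, as the group of linear automorphisms of `ℝ⁴` preserving
the Lorentzian form and the upper sheet of the hyperboloid. -/
def isometryGroup : Subgroup ((Fin 4 → ℝ) ≃ₗ[ℝ] (Fin 4 → ℝ)) where
  carrier := {g | (∀ x y, lor (g x) (g y) = lor x y) ∧ ∀ x : H3, 0 < g x.1 0}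
  mul_mem' {g h} hg hh := ⟨fun x y => (hg.1 _ _).trans (hh.1 _ _),
    fun x => hg.2 ⟨h x.1, (hh.1 _ _).trans x.2.1, hh.2 x⟩⟩
  one_mem' := ⟨fun _ _ => rfl, fun x => x.2.2⟩
  inv_mem' {g} hg := by
    have hinv : ∀ x, g (g⁻¹ x) = x := g.apply_symm_apply
    have hadj : ∀ x y, lor (g⁻¹ x) y = lor x (g y) := fun x y => by rw [← hg.1, hinv]
    refine ⟨fun x y => by rw [hadj, hinv], fun x => ?_⟩
    refine pos_zero_of_lor_neg x (by rw [hadj, hinv, x.2.1]; norm_num) ?_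
    rw [hadj]
    exact x.lor_neg ⟨g x.1, (hg.1 _ _).trans x.2.1, hg.2 x⟩

theorem lor_isometry_smul (g : isometryGroup) (x y : Fin 4 → ℝ) :
    lor (g • x) (g • y) = lor x y :=
  g.2.1 x y

theorem lor_inv_isometry_smul (g : isometryGroup) (x y : Fin 4 → ℝ) :
    lor (g⁻¹ • x) y = lor x (g • y) := by
  rw [← lor_isometry_smul g, smul_inv_smul]

instance : MulAction isometryGroup H3 where
  smul g x := ⟨g • x.1, (lor_isometry_smul g _ _).trans x.2.1, g.2.2 x⟩
  one_smul _ := rfl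
  mul_smul _ _ _ := rfl

instance : MulAction isometryGroup Normal where
  smul g u := ⟨g • u.1, (lor_isometry_smul g _ _).trans u.2⟩
  one_smul _ := rfl
  mul_smul _ _ _ := rfl

theorem H3.coe_isometry_smul (g : isometryGroup) (x : H3) : (g • x).1 = g • x.1 := rfl

theorem Normal.coe_isometry_smul (g : isometryGroup) (u : Normal) : (g • u).1 = g • u.1 := rfl

variable (g : isometryGroup)

theorem smul_plane (u : Normal) : g • plane u = plane (g • u) := by
  ext x
  rw [Set.mem_smul_set_iff_inv_smul_mem]
  exact Eq.congr_left (lor_inv_isometry_smul g x.1 u.1)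

theorem smul_halfSpace (u : Normal) : g • halfSpace u = halfSpace (g • u) := by
  ext x
  rw [Set.mem_smul_set_iff_inv_smul_mem]
  exact iff_of_eq (congrArg (· ≤ 0) (lor_inv_isometry_smul g x.1 u.1))

theorem smul_mem_segment {x y z : H3} (hz : z ∈ segment x y) : g • z ∈ segment (g • x) (g • y) := by
  obtain ⟨a, b, ha, hb, hz⟩ := hz
  refine ⟨a, b, ha, hb, ?_⟩
  simp only [H3.coe_isometry_smul, hz, smul_add, smul_comm g]

theorem smul_segment (x y : H3) : g • segment x y = segment (g • x) (g • y) := by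
  refine Set.Subset.antisymm ?_ fun z hz => ?_
  · rintro _ ⟨z, hz, rfl⟩
    exact smul_mem_segment g hz
  · rw [Set.mem_smul_set_iff_inv_smul_mem]
    simpa using smul_mem_segment g⁻¹ hz

theorem IsConvex.smul {K : Set H3} (hK : IsConvex K) : IsConvex (g • K) := by
  rintro _ ⟨x, hx, rfl⟩ _ ⟨y, hy, rfl⟩
  exact smul_segment g x y ▸ Set.smul_set_mono (hK x hx y hy)

theorem hull_smul_subset (s : Set H3) : hull (g • s) ⊆ g • hull s := by
  intro x hx
  rw [Set.mem_smul_set_iff_inv_smul_mem]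
  rintro K ⟨hK, hs⟩
  exact Set.mem_smul_set_iff_inv_smul_mem.1 (hx (g • K) ⟨hK.smul g, Set.smul_set_mono hs⟩)

theorem smul_hull (s : Set H3) : g • hull s = hull (g • s) := by
  refine Set.Subset.antisymm ?_ (hull_smul_subset g s)
  rw [Set.smul_set_subset_iff_subset_inv_smul_set]
  simpa using hull_smul_subset g⁻¹ (g • s)

theorem linearSpan_smul (s : Set H3) : linearSpan (g • s) = (linearSpan s).map g.1.toLinearMap := by
  rw [linearSpan, Submodule.map_span, ← Set.image_smul, Set.image_image, Set.image_image]
  rfl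

variable {g}

theorem IsFaceWithNormal.smul {k : ℕ} {K F : Set H3} {u : Normal} (h : IsFaceWithNormal k K F u) :
    IsFaceWithNormal k (g • K) (g • F) (g • u) := by
  obtain ⟨hsupp, hF, hdim⟩ := h
  refine ⟨?_, ?_, ?_⟩
  · rw [← smul_halfSpace]
    exact Set.smul_set_mono hsupp
  · rw [hF, Set.smul_set_inter, smul_plane]
  · exact ((congrArg (fun S : Submodule ℝ (Fin 4 → ℝ) => Module.finrank ℝ S)
      (linearSpan_smul g F)).trans (LinearEquiv.finrank_map_eq g.1 _)).trans hdim

theorem IsFace.smul {k : ℕ} {K F : Set H3} (h : IsFace k K F) : IsFace k (g • K) (g • F) :=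
  h.imp' (g • ·) fun _ => IsFaceWithNormal.smul

theorem hdist_smul (x y : H3) : hdist (g • x) (g • y) = hdist x y := by
  simp only [hdist, H3.coe_isometry_smul, lor_isometry_smul]

theorem toward_smul (p x : H3) : toward (g • p) (g • x) = g • toward p x := by
  simp only [toward, H3.coe_isometry_smul, lor_isometry_smul, smul_add, smul_comm g]

theorem angle_smul (x p y : H3) : angle (g • x) (g • p) (g • y) = angle x p y := by
  simp only [angle, toward_smul, lor_isometry_smul]

theorem IsRegularRightAngledPolygon.smul {n : ℕ} {F : Set H3}
    (h : IsRegularRightAngledPolygon n F) : IsRegularRightAngledPolygon n (g • F) := by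
  obtain ⟨⟨u, hu⟩, v, hv, hF, hside, ⟨r, hr⟩, hangle⟩ := h
  refine ⟨⟨g • u, smul_plane g u ▸ Set.smul_set_mono hu⟩, fun i => g • v i,
    (MulAction.injective g).comp hv, ?_, fun i => ?_, ⟨r, fun i => ?_⟩, fun i => ?_⟩
  · rw [hF, smul_hull, ← Set.image_smul, ← Set.range_comp]
    rfl
  · exact smul_segment g (v i) (v (i + 1)) ▸ (hside i).smul
  · exact (hdist_smul _ _).trans (hr i)
  · exact (angle_smul _ _ _).trans (hangle i)

end Isometries

/-! ### Reflection groups -/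

section Chebyshev

open Polynomial.Chebyshev

theorem sin_two_mul_pi_div_pos {m : ℕ} (hm : 2 < m) : 0 < Real.sin (2 * (Real.pi / m)) := by
  have hm' : (2 : ℝ) < m := by exact_mod_cast hm
  apply Real.sin_pos_of_pos_of_lt_pi (by positivity)
  rw [mul_div_assoc', div_lt_iff₀ (by positivity)]
  nlinarith [Real.pi_pos]

theorem S_eval_two_mul_cos_of_even {m k : ℕ} (hm : 2 < m) (hk : m = 2 * k) :
    (S ℝ (k - 1)).eval (2 * Real.cos (2 * (Real.pi / m))) = 0 := by
  have hangle : ((k - 1 : ℤ) + 1 : ℝ) * (2 * (Real.pi / m)) = Real.pi := by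
    have hk' : (m : ℝ) = 2 * k := by exact_mod_cast hk
    push_cast
    field_simp
    linarith
  have hS := S_two_mul_real_cos (2 * (Real.pi / m)) (k - 1)
  rw [hangle, Real.sin_pi] at hS
  exact (mul_eq_zero.1 hS).resolve_right (sin_two_mul_pi_div_pos hm).ne'

theorem S_eval_two_mul_cos_of_odd {m k : ℕ} (hm : 2 < m) (hk : m = 2 * k + 1) :
    (S ℝ k).eval (2 * Real.cos (2 * (Real.pi / m))) +
      (S ℝ (k - 1)).eval (2 * Real.cos (2 * (Real.pi / m))) = 0 := by
  have hk' : (m : ℝ) = 2 * k + 1 := by exact_mod_cast hk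
  have hangle₀ : ((k : ℤ) + 1 : ℝ) * (2 * (Real.pi / m)) = Real.pi / m + Real.pi := by
    push_cast
    field_simp
    linarith
  have hangle₁ : ((k - 1 : ℤ) + 1 : ℝ) * (2 * (Real.pi / m)) = Real.pi - Real.pi / m := by
    push_cast
    field_simp
    linarith
  have hS₀ := S_two_mul_real_cos (2 * (Real.pi / m)) k
  have hS₁ := S_two_mul_real_cos (2 * (Real.pi / m)) (k - 1)
  rw [hangle₀, Real.sin_add_pi] at hS₀
  rw [hangle₁, Real.sin_pi_sub] at hS₁
  refine (mul_eq_zero.1 ?_).resolve_right (sin_two_mul_pi_div_pos hm).ne'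
  rw [add_mul, hS₀, hS₁, neg_add_cancel]

theorem reflection_mul_reflection_pow_eq_one {V : Type*} [AddCommGroup V] [Module ℝ V] {x y : V}
    {f g : Module.Dual ℝ V} (hf : f x = 2) (hg : g y = 2) {m : ℕ} (hm : 2 ≤ m)
    (hfy : f y = -(2 * Real.cos (Real.pi / m))) (hgx : g x = -(2 * Real.cos (Real.pi / m))) :
    (Module.reflection hf * Module.reflection hg) ^ m = 1 := by
  ext z
  have htrace : 2 * Real.cos (2 * (Real.pi / m)) = f y * g x - 2 := by
    rw [hfy, hgx, Real.cos_two_mul]; ring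
  rw [Module.reflection_mul_reflection_pow_apply hf hg m z _ htrace]
  rcases hm.eq_or_lt with rfl | hm
  · rw [Nat.cast_ofNat, Real.cos_pi_div_two] at hfy hgx
    simp [hfy, hgx, mul_div_cancel₀, add_assoc, show (-2 + 1 : ℝ) = -1 by norm_num]
  obtain ⟨k, hk | hk⟩ := m.even_or_odd'
  · rw [show ((m : ℤ) - 2) / 2 = k - 1 by lia, show ((m : ℤ) - 1) / 2 = k - 1 by lia,
      S_eval_two_mul_cos_of_even hm hk]
    simp
  · rw [show ((m : ℤ) - 2) / 2 = k - 1 by lia, show ((m : ℤ) - 1) / 2 = k by lia,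
      show ((m : ℤ) - 3) / 2 = k - 1 by lia, show (m : ℤ) / 2 = k by lia,
      S_eval_two_mul_cos_of_odd hm hk]
    simp

end Chebyshev

theorem two_smul_lorForm_apply_self (u : Normal) : ((2 : ℝ) • lorForm u.1) u.1 = 2 := by
  have hu : lorForm u.1 u.1 = 1 := u.2
  rw [LinearMap.smul_apply, hu, smul_eq_mul, mul_one]

/-- The reflection in the plane with unit normal `u`. -/
def reflection (u : Normal) : isometryGroup :=
  ⟨Module.reflection (two_smul_lorForm_apply_self u), by
    have happly : ∀ x, Module.reflection (two_smul_lorForm_apply_self u) x =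
        x - (2 * lor u.1 x) • u.1 := fun x => rfl
    have hlor : ∀ x y, lor (Module.reflection (two_smul_lorForm_apply_self u) x)
        (Module.reflection (two_smul_lorForm_apply_self u) y) = lor x y := fun x y => by
      simp only [happly, lor_sub_left, lor_sub_right, lor_smul_left, lor_smul_right, u.2,
        lor_comm x u.1]
      ring
    refine ⟨hlor, fun x => pos_zero_of_lor_neg x (by rw [hlor, x.2.1]; norm_num) ?_⟩
    rw [happly, lor_sub_left, lor_smul_left, x.2.1]
    nlinarith [sq_nonneg (lor u.1 x.1)]⟩

theorem reflection_smul (u : Normal) (x : Fin 4 → ℝ) :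
    reflection u • x = x - (2 * lor x u.1) • u.1 := by
  rw [lor_comm]; rfl

theorem reflection_smul_of_mem_plane {u : Normal} {x : Fin 4 → ℝ} (h : lor x u.1 = 0) :
    reflection u • x = x := by
  rw [reflection_smul, h, mul_zero, zero_smul, sub_zero]

/-- The normals `a i` bound a chamber with dihedral angles `π / M i j`. -/
structure IsCoxeterChamber {B : Type*} (M : CoxeterMatrix B) (a : B → Normal) : Prop where
  ne_zero : ∀ i j, M i j ≠ 0
  lor_eq : ∀ i j, lor (a i).1 (a j).1 = -Real.cos (Real.pi / M i j)

namespace IsCoxeterChamber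

variable {B : Type*} {M : CoxeterMatrix B} {a : B → Normal} (h : IsCoxeterChamber M a)
include h

theorem isLiftable : M.IsLiftable fun i => reflection (a i) := by
  intro i j
  apply Subtype.ext
  rcases eq_or_ne i j with rfl | hij
  · rw [M.diagonal, pow_one]
    exact LinearEquiv.ext (Module.involutive_reflection (two_smul_lorForm_apply_self (a i)))
  have hM : 2 ≤ M i j := by
    have h0 := h.ne_zero i j
    have h1 := M.off_diagonal i j hij
    omega
  refine reflection_mul_reflection_pow_eq_one (two_smul_lorForm_apply_self (a i))
    (two_smul_lorForm_apply_self (a j)) hM ?_ ?_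
  · change 2 * lor (a i).1 (a j).1 = _
    rw [h.lor_eq]; ring
  · change 2 * lor (a j).1 (a i).1 = _
    rw [h.lor_eq, M.symmetric]; ring

/-- The homomorphism from the abstract Coxeter group that sends each generator to the reflection in
the corresponding wall of the chamber. -/
def toIsometryGroup : M.Group →* isometryGroup :=
  M.toCoxeterSystem.lift ⟨_, h.isLiftable⟩

theorem toIsometryGroup_simple (i : B) : h.toIsometryGroup (M.simple i) = reflection (a i) :=
  M.toCoxeterSystem.lift_apply_simple h.isLiftable i

theorem actsAsOnSimpleRoots : ActsAsOnSimpleRoots M.toCoxeterSystem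
    ((LinearEquiv.automorphismGroup.toLinearMapMonoidHom).comp
      (isometryGroup.subtype.comp h.toIsometryGroup)) fun i => (a i).1 := by
  intro i j
  change h.toIsometryGroup (M.simple i) • (a j).1 = _
  rw [h.toIsometryGroup_simple, reflection_smul, lor_comm, h.lor_eq]
  module

theorem lor_smul_nonpos {x : Fin 4 → ℝ} (hx : ∀ i, lor x (a i).1 ≤ 0) {w : M.Group} {i : B}
    (hw : ¬ M.toCoxeterSystem.IsLeftDescent w i) :
    lor (h.toIsometryGroup w • x) (a i).1 ≤ 0 := by
  rw [← inv_inv w, map_inv, lor_inv_isometry_smul]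
  rw [← M.toCoxeterSystem.isRightDescent_inv_iff] at hw
  exact h.actsAsOnSimpleRoots.map_nonpos_of_not_isRightDescent h.ne_zero (f := lorForm x) hx hw

theorem smul_mem_of_forall_reflection_smul_mem {S : Set Normal} {u : Normal} (huS : u ∈ S)
    (hu : ∀ i, lor u.1 (a i).1 ≤ 0)
    (hS : ∀ i, ∀ v ∈ S, lor v.1 (a i).1 ≤ 0 → reflection (a i) • v ∈ S) (w : M.Group) :
    h.toIsometryGroup w • u ∈ S := by
  obtain ⟨l, hl⟩ : ∃ l, M.toCoxeterSystem.length w = l := ⟨_, rfl⟩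
  induction l using Nat.strong_induction_on generalizing w with
  | _ l ih =>
    rcases eq_or_ne w 1 with rfl | hw
    · rwa [map_one, one_smul]
    obtain ⟨i, hi⟩ := M.toCoxeterSystem.exists_leftDescent_of_ne_one hw
    have hnot := M.toCoxeterSystem.isLeftDescent_iff_not_isLeftDescent_mul.1 hi
    have hcancel := M.toCoxeterSystem.simple_mul_simple_cancel_left (w := w) i
    rw [← hcancel, map_mul, mul_smul, show h.toIsometryGroup (M.toCoxeterSystem.simple i) = _ from
      h.toIsometryGroup_simple i]
    exact hS i _ (ih _ (hl ▸ hi) _ rfl) (h.lor_smul_nonpos hu hnot)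

end IsCoxeterChamber

/-! ### Right-angled polyhedra -/

open Filter Topology

/-- The intersection of the half-spaces with outward normals in `O`. -/
def cell (O : Set Normal) : Set H3 := ⋂ u ∈ O, halfSpace u

theorem mem_cell {O : Set Normal} {x : H3} : x ∈ cell O ↔ ∀ u ∈ O, lor x.1 u.1 ≤ 0 := by
  simp [cell, halfSpace]

theorem cell_subset_halfSpace {O : Set Normal} {u : Normal} (hu : u ∈ O) :
    cell O ⊆ halfSpace u :=
  Set.biInter_subset_of_mem hu

theorem isConvex_cell (O : Set Normal) : IsConvex (cell O) := by
  intro x hx y hy z hz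
  rw [mem_cell] at hx hy ⊢
  exact fun u hu => isConvex_halfSpace u x (hx u hu) y (hy u hu) hz

/-- The span of a family of normals. -/
abbrev normalSpan (S : Set Normal) : Submodule ℝ (Fin 4 → ℝ) :=
  Submodule.span ℝ (Subtype.val '' S)

theorem finrank_normalSpan {S : Set Normal} (hS : S.Pairwise fun u v => lor u.1 v.1 = 0) :
    S.Finite ∧ Module.finrank ℝ (normalSpan S) = S.ncard := by
  have hind : LinearIndependent ℝ fun u : S => u.1.1 := by
    refine LinearMap.linearIndependent_of_isOrthoᵢ (B := lorForm) (fun u v huv => ?_) fun u => ?_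
    · exact hS u.2 v.2 (Subtype.coe_injective.ne huv)
    · exact ne_of_eq_of_ne u.1.2 one_ne_zero
  have := hind.finite
  refine ⟨Set.toFinite S, ?_⟩
  rw [normalSpan, Set.image_eq_range, Module.finrank_eq_nat_card_basis (Module.Basis.span hind),
    Nat.card_coe_set_eq]

theorem lor_neg_of_zero_le {x : H3} {u : Normal} (h : x.1 0 ≤ u.1 0) : lor x.1 u.1 < 0 := by
  have hx0 := x.2.2
  have hcs := lor_add_mul_sq_le x.1 u.1
  rw [x.2.1, u.2] at hcs
  have hlt : (lor x.1 u.1 + x.1 0 * u.1 0) ^ 2 < (x.1 0 * u.1 0) ^ 2 := by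
    nlinarith [pow_le_pow_left₀ hx0.le h 2]
  linarith [lt_of_pow_lt_pow_left₀ 2 (by positivity [hx0.trans_le h]) hlt]

theorem one_half_le_dist {u v : Normal} (h : lor u.1 v.1 ≤ 0) : 1 / 2 ≤ dist u.1 v.1 := by
  by_contra! hdist
  have hcoord (i : Fin 4) : (u.1 - v.1) i ^ 2 ≤ (1 / 2) ^ 2 := by
    have hi := (norm_le_pi_norm (u.1 - v.1) i).trans_eq (dist_eq_norm u.1 v.1).symm
    exact sq_le_sq.2 ((hi.trans hdist.le).trans (le_abs_self _))
  have hlor : 2 ≤ lor (u.1 - v.1) (u.1 - v.1) := by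
    simp only [lor_sub_left, lor_sub_right, u.2, v.2, lor_comm v.1 u.1]
    linarith
  have hsq := lor_self_add_sq (u.1 - v.1)
  nlinarith [hcoord 1, hcoord 2, hcoord 3, sq_nonneg ((u.1 - v.1) 0)]

theorem finite_of_pairwise_lor_nonpos {O : Set Normal} {R : ℝ}
    (hO : O.Pairwise fun u v => lor u.1 v.1 ≤ 0) (hR : ∀ u ∈ O, |u.1 0| ≤ R) : O.Finite := by
  have hdist : (Subtype.val '' O).Pairwise fun x y => 1 / 2 ≤ dist x y := by
    rintro _ ⟨u, hu, rfl⟩ _ ⟨v, hv, rfl⟩ huv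
    exact one_half_le_dist (hO hu hv (ne_of_apply_ne _ huv))
  have hdiscrete : DiscreteTopology (Subtype.val '' O) :=
    .of_forall_le_dist one_half_pos fun x y hxy => hdist x.2 y.2 (Subtype.coe_injective.ne hxy)
  have hbounded : Bornology.IsBounded (Subtype.val '' O) := by
    refine isBounded_iff_forall_norm_le.2 ⟨1 + R, ?_⟩
    rintro _ ⟨u, hu, rfl⟩
    have hu0 := abs_le.1 (hR u hu)
    have hsq := u.2 ▸ lor_self_add_sq u.1
    refine (pi_norm_le_iff_of_nonneg (by linarith)).2 fun i => abs_le_of_sq_le_sq ?_ (by linarith)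
    fin_cases i <;> simp only [Fin.zero_eta, Fin.mk_one, Fin.reduceFinMk] <;>
      nlinarith [sq_nonneg (u.1 1), sq_nonneg (u.1 2), sq_nonneg (u.1 3)]
  refine Set.Finite.of_finite_image ?_ Subtype.val_injective.injOn
  rw [← Set.inter_self (Subtype.val '' O)]
  exact Metric.finite_isBounded_inter_isClosed hdiscrete.isDiscrete hbounded
    (Metric.isClosed_of_pairwise_le_dist one_half_pos hdist)

/-- The half-spaces with outward normals in `O` all contain `b` in their interior, and any two of
their bounding planes are orthogonal or do not meet. -/
structure RightAngled (O : Set Normal) (b : H3) : Prop where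
  lor_eq_zero_or_le : ∀ u ∈ O, ∀ v ∈ O, u ≠ v → lor u.1 v.1 = 0 ∨ lor u.1 v.1 ≤ -1
  lor_base_neg : ∀ u ∈ O, lor b.1 u.1 < 0

theorem continuous_lor_left (u : Fin 4 → ℝ) : Continuous fun y : H3 => lor y.1 u := by
  simp only [lor_comm _ u]
  exact (lorForm u).continuous_of_finiteDimensional.comp continuous_subtype_val

theorem setOf_zero_lt_mem_nhds (x : H3) : {y : H3 | y.1 0 < x.1 0 + 1} ∈ 𝓝 x :=
  ((continuous_apply 0).comp continuous_subtype_val).continuousAt.eventually_lt_const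
    (lt_add_one (x.1 0))

namespace RightAngled

variable {O : Set Normal} {b : H3} (hO : RightAngled O b)
include hO

theorem finite_setOf_zero_le (R : ℝ) : {u ∈ O | u.1 0 ≤ R}.Finite := by
  refine finite_of_pairwise_lor_nonpos (R := max (b.1 0) R) ?_ ?_
  · rintro u ⟨hu, -⟩ v ⟨hv, -⟩ huv
    rcases hO.lor_eq_zero_or_le u hu v hv huv with h | h <;> linarith
  · rintro u ⟨hu, huR⟩
    refine abs_le.2 ⟨?_, huR.trans (le_max_right _ _)⟩
    by_contra! hlt
    have hneg := lor_neg_of_zero_le (x := b) (u := ⟨-u.1, by simp [u.2]⟩) (by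
      change b.1 0 ≤ -u.1 0
      linarith [le_max_left (b.1 0) R])
    rw [lor_neg_right] at hneg
    linarith [hO.lor_base_neg u hu]

theorem eventually_lor_neg (x : H3) :
    ∀ᶠ y in 𝓝 x, ∀ u ∈ O, lor x.1 u.1 < 0 → lor y.1 u.1 < 0 := by
  have hfinite : ∀ᶠ y : H3 in 𝓝 x, ∀ u ∈ {u ∈ O | u.1 0 ≤ x.1 0 + 1},
      lor x.1 u.1 < 0 → lor y.1 u.1 < 0 := by
    refine (Filter.eventually_all_finite (hO.finite_setOf_zero_le _)).2 fun u _ => ?_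
    exact Filter.eventually_imp_distrib_left.2 fun h =>
      (continuous_lor_left u.1).continuousAt.eventually_lt_const h
  filter_upwards [setOf_zero_lt_mem_nhds x, hfinite] with y hy hyu u hu hxu
  rcases le_total (u.1 0) (x.1 0 + 1) with h | h
  · exact hyu u ⟨hu, h⟩ hxu
  · exact lor_neg_of_zero_le (hy.le.trans h)

theorem locallyFinite : LocallyFinite fun u : O => plane u.1 := by
  refine fun x => ⟨_, setOf_zero_lt_mem_nhds x, ?_⟩
  refine ((hO.finite_setOf_zero_le (x.1 0 + 1)).preimage Subtype.val_injective.injOn).subset ?_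
  rintro u ⟨y, hyu, hy⟩
  refine ⟨u.2, ?_⟩
  by_contra! hlt
  exact (lor_neg_of_zero_le (hy.trans hlt).le).ne hyu

theorem isConvexPolyhedron_cell : IsConvexPolyhedron (cell O) where
  convex := isConvex_cell O
  interior_nonempty := by
    refine ⟨b, mem_interior_iff_mem_nhds.2 ?_⟩
    filter_upwards [hO.eventually_lor_neg b] with y hy
    exact mem_cell.2 fun u hu => (hy u hu (hO.lor_base_neg u hu)).le
  halfSpaces := ⟨O, hO.locallyFinite, rfl⟩

theorem lor_eq_zero_of_mem_plane {u v : Normal} (hu : u ∈ O) (hv : v ∈ O) (huv : u ≠ v) {x : H3}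
    (hxu : x ∈ plane u) (hxv : x ∈ plane v) : lor u.1 v.1 = 0 := by
  refine (hO.lor_eq_zero_or_le u hu v hv huv).resolve_right fun hle => ?_
  have hsum_base : lor b.1 (u.1 + v.1) < 0 := by
    rw [lor_add_right]
    linarith [hO.lor_base_neg u hu, hO.lor_base_neg v hv]
  have hsum_ne : u.1 + v.1 ≠ 0 := fun h => by
    rw [h, lor_comm, lor_zero_left] at hsum_base
    exact hsum_base.false
  have hsum_x : lor (u.1 + v.1) x.1 = 0 := by
    rw [lor_comm, lor_add_right, show lor x.1 u.1 = 0 from hxu, show lor x.1 v.1 = 0 from hxv,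
      add_zero]
  have hpos := lor_self_pos_of_lor_eq_zero (by simp [x.2.1]) hsum_x hsum_ne
  simp only [lor_add_left, lor_add_right, u.2, v.2, lor_comm v.1 u.1] at hpos
  linarith

end RightAngled

/-- The hyperbola through `x` with velocity `t` at `x`, a reparametrized geodesic. -/
def tangentCurve (x : H3) {t : Fin 4 → ℝ} (ht : lor t x.1 = 0) (s : ℝ) : H3 :=
  ⟨√(1 + s ^ 2 * lor t t) • x.1 + s • t, by
    have hnonneg : 0 ≤ lor t t := lor_self_nonneg_of_lor_eq_zero (by simp [x.2.1]) ht
    have hsq : √(1 + s ^ 2 * lor t t) * √(1 + s ^ 2 * lor t t) = 1 + s ^ 2 * lor t t :=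
      Real.mul_self_sqrt (by positivity)
    have hlor : lor (√(1 + s ^ 2 * lor t t) • x.1 + s • t)
        (√(1 + s ^ 2 * lor t t) • x.1 + s • t) = -1 := by
      simp only [lor_add_left, lor_add_right, lor_smul_left, lor_smul_right, lor_comm x.1 t, ht,
        x.2.1]
      linear_combination -hsq
    refine ⟨hlor, pos_zero_of_lor_neg x (by rw [hlor]; norm_num) ?_⟩
    rw [lor_add_left, lor_smul_left, lor_smul_left, ht, x.2.1]
    have : 0 < √(1 + s ^ 2 * lor t t) := by positivity
    linarith⟩

theorem continuous_tangentCurve (x : H3) {t : Fin 4 → ℝ} (ht : lor t x.1 = 0) :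
    Continuous (tangentCurve x ht) := by
  unfold tangentCurve
  fun_prop

theorem tangentCurve_zero (x : H3) {t : Fin 4 → ℝ} (ht : lor t x.1 = 0) :
    tangentCurve x ht 0 = x := by
  ext1
  simp [tangentCurve]

/-- The normals in `O` of the planes containing `F`. -/
def normalsThrough (O : Set Normal) (F : Set H3) : Set Normal := {u ∈ O | F ⊆ plane u}

/-- The part of the cell of `O` lying in all planes with normals in `S`. -/
def stratum (O S : Set Normal) : Set H3 := {x ∈ cell O | ∀ u ∈ S, x ∈ plane u}

theorem stratum_singleton (O : Set Normal) (u : Normal) : stratum O {u} = cell O ∩ plane u := by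
  ext x
  simp [stratum]

theorem stratum_pair (O : Set Normal) (u v : Normal) :
    stratum O {u, v} = cell O ∩ plane u ∩ plane v := by
  ext x
  simp only [stratum, Set.forall_mem_insert, Set.mem_singleton_iff, forall_eq, Set.mem_ofPred_eq,
    Set.mem_inter_iff, and_assoc]

theorem IsFace.nonempty {k : ℕ} {K F : Set H3} (h : IsFace k K F) : F.Nonempty := by
  obtain ⟨u, -, -, hdim⟩ := h
  by_contra! hempty
  rw [hempty, Set.image_empty, Submodule.span_empty, finrank_bot] at hdim
  omega

theorem IsFace.subset {k : ℕ} {K F : Set H3} (h : IsFace k K F) : F ⊆ K := by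
  obtain ⟨u, -, rfl, -⟩ := h
  exact Set.inter_subset_left

theorem IsFace.finrank_linearSpan {k : ℕ} {K F : Set H3} (h : IsFace k K F) :
    Module.finrank ℝ (linearSpan F) = k + 1 :=
  h.choose_spec.2.2

namespace RightAngled

variable {O : Set Normal} {b : H3} (hO : RightAngled O b)
include hO

theorem exists_mem_cell_of_lor_nonpos {x : H3} (hx : x ∈ cell O) {t : Fin 4 → ℝ}
    (htx : lor t x.1 = 0) (ht : ∀ u ∈ O, x ∈ plane u → lor t u.1 ≤ 0) :
    ∃ y ∈ cell O, ∃ c s : ℝ, 0 < s ∧ y.1 = c • x.1 + s • t := by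
  have htendsto : Tendsto (tangentCurve x htx) (𝓝[>] 0) (𝓝 x) := by
    have := (continuous_tangentCurve x htx).tendsto 0
    rw [tangentCurve_zero] at this
    exact this.mono_left nhdsWithin_le_nhds
  obtain ⟨s, hs, hs0⟩ :=
    ((htendsto.eventually (hO.eventually_lor_neg x)).and self_mem_nhdsWithin).exists
  refine ⟨tangentCurve x htx s, mem_cell.2 fun u hu => ?_, _, s, hs0, rfl⟩
  rcases (mem_cell.1 hx u hu).lt_or_eq with hlt | heq
  · exact (hs u hu hlt).le
  · rw [tangentCurve, lor_add_left, lor_smul_left, lor_smul_left, heq, mul_zero, zero_add]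
    exact mul_nonpos_of_nonneg_of_nonpos (Set.mem_Ioi.1 hs0).le (ht u hu heq)

theorem mem_linearSpan_stratum {x : H3} {S : Set Normal} (hx : x ∈ stratum O S)
    {t : Fin 4 → ℝ} (htx : lor t x.1 = 0) (ht : ∀ u ∈ O, x ∈ plane u → lor t u.1 ≤ 0)
    (htS : ∀ u ∈ S, lor t u.1 = 0) : t ∈ linearSpan (stratum O S) := by
  obtain ⟨y, hy, c, s, hs, hyxt⟩ := hO.exists_mem_cell_of_lor_nonpos hx.1 htx ht
  have hyS : y ∈ stratum O S := ⟨hy, fun u hu => by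
    rw [plane, Set.mem_ofPred_eq, hyxt, lor_add_left, lor_smul_left, lor_smul_left, htS u hu,
      show lor x.1 u.1 = 0 from hx.2 u hu, mul_zero, mul_zero, add_zero]⟩
  have ht_eq : t = s⁻¹ • (y.1 - c • x.1) := by
    rw [hyxt, add_sub_cancel_left, smul_smul, inv_mul_cancel₀ hs.ne', one_smul]
  rw [ht_eq]
  exact Submodule.smul_mem _ _
    (sub_mem (mem_linearSpan hyS) (Submodule.smul_mem _ _ (mem_linearSpan hx)))

theorem mem_linearSpan_of_tangent {w : Normal} (hw : cell O ⊆ halfSpace w) {x : H3}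
    (hx : x ∈ stratum O {w}) {t : Fin 4 → ℝ} (htx : lor t x.1 = 0)
    (ht : ∀ u ∈ O, x ∈ plane u → lor t u.1 = 0) : t ∈ linearSpan (stratum O {w}) := by
  have hxw : lor x.1 w.1 = 0 := hx.2 w rfl
  have hsupport (r : Fin 4 → ℝ) (hrx : lor r x.1 = 0)
      (hr : ∀ u ∈ O, x ∈ plane u → lor r u.1 = 0) : lor r w.1 ≤ 0 := by
    obtain ⟨y, hy, c, s, hs, hyxr⟩ :=
      hO.exists_mem_cell_of_lor_nonpos hx.1 hrx fun u hu hxu => (hr u hu hxu).le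
    have hyw : lor y.1 w.1 ≤ 0 := hw hy
    rw [hyxr, lor_add_left, lor_smul_left, lor_smul_left, hxw, mul_zero, zero_add] at hyw
    exact nonpos_of_mul_nonpos_right hyw hs
  have htw : lor t w.1 = 0 := by
    refine (hsupport t htx ht).antisymm ?_
    simpa using hsupport (-t) (by simp [htx]) fun u hu hxu => by simp [ht u hu hxu]
  exact hO.mem_linearSpan_stratum hx htx (fun u hu hxu => (ht u hu hxu).le) (by simpa using htw)

theorem exists_normal_notMem {k : ℕ} {F : Set H3} (hF : IsFace k (cell O) F)
    {T : Submodule ℝ (Fin 4 → ℝ)} (hT : Module.finrank ℝ T + k < 3) :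
    ∃ u ∈ normalsThrough O F, u.1 ∉ T := by
  obtain ⟨w, hw, hFw, -⟩ := id hF
  have hF_eq : F = stratum O {w} := hFw.trans (stratum_singleton O w).symm
  have hconvex : IsConvex F := hFw ▸ (isConvex_cell O).inter (isConvex_plane w)
  obtain ⟨x, hx, hrel⟩ := hconvex.exists_mem_forall_subset_plane hF.nonempty
  obtain ⟨t, ht0, ht⟩ := exists_ne_zero_forall_lor_eq_zero (S := linearSpan F ⊔ T) (by
    have hle := Submodule.finrank_add_le_finrank_add_finrank (linearSpan F) T
    rw [hF.finrank_linearSpan] at hle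
    omega)
  have htF : ∀ y ∈ linearSpan F, lor t y = 0 := fun y hy =>
    (lor_comm t y).trans (ht y (Submodule.mem_sup_left hy))
  have htx := htF x.1 (mem_linearSpan hx)
  by_contra! hall
  have htangent : ∀ u ∈ O, x ∈ plane u → lor t u.1 = 0 := fun u hu hxu =>
    (lor_comm t u.1).trans (ht u.1 (Submodule.mem_sup_right
      (hall u ⟨hu, hrel u (hF.subset.trans (cell_subset_halfSpace hu)) hxu⟩)))
  have htmem : t ∈ linearSpan F := by
    rw [hF_eq] at hx ⊢
    exact hO.mem_linearSpan_of_tangent hw hx htx htangent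
  exact (lor_self_pos_of_lor_eq_zero (by simp [x.2.1]) htx ht0).ne' (htF t htmem)

theorem pairwise_normalsThrough {F : Set H3} (hF : F.Nonempty) :
    (normalsThrough O F).Pairwise fun u v => lor u.1 v.1 = 0 := by
  obtain ⟨x, hx⟩ := hF
  exact fun u hu v hv huv => hO.lor_eq_zero_of_mem_plane hu.1 hv.1 huv (hu.2 hx) (hv.2 hx)

theorem normalSpan_normalsThrough {k : ℕ} {F : Set H3} (hF : IsFace k (cell O) F) :
    normalSpan (normalsThrough O F) = lorForm.orthogonal (linearSpan F) := by
  have horth := LinearMap.BilinForm.finrank_orthogonal lorForm_nondegenerate (linearSpan F)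
  rw [Module.finrank_fin_fun, hF.finrank_linearSpan] at horth
  refine Submodule.eq_of_le_of_finrank_le (Submodule.span_le.2 ?_) ?_
  · rintro _ ⟨u, hu, rfl⟩
    exact LinearMap.BilinForm.mem_orthogonal_iff.2
      fun x hx => lor_eq_zero_of_mem_linearSpan hu.2 hx
  · by_contra! hlt
    obtain ⟨u, hu, hu'⟩ := hO.exists_normal_notMem hF (T := normalSpan (normalsThrough O F))
      (by omega)
    exact hu' (Submodule.subset_span ⟨u, hu, rfl⟩)

theorem mem_normalSpan_normalsThrough {k : ℕ} {F : Set H3} {w : Normal}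
    (hF : IsFaceWithNormal k (cell O) F w) : w.1 ∈ normalSpan (normalsThrough O F) := by
  rw [hO.normalSpan_normalsThrough ⟨w, hF⟩]
  exact LinearMap.BilinForm.mem_orthogonal_iff.2
    fun x hx => lor_eq_zero_of_mem_linearSpan (hF.2.1 ▸ Set.inter_subset_right) hx

theorem ncard_normalsThrough {k : ℕ} {F : Set H3} (hF : IsFace k (cell O) F) :
    (normalsThrough O F).ncard = 3 - k := by
  rw [← (finrank_normalSpan (hO.pairwise_normalsThrough hF.nonempty)).2,
    hO.normalSpan_normalsThrough hF,
    LinearMap.BilinForm.finrank_orthogonal lorForm_nondegenerate, hF.finrank_linearSpan,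
    Module.finrank_fin_fun]
  omega

theorem stratum_normalsThrough {k : ℕ} {F : Set H3} (hF : IsFace k (cell O) F) :
    stratum O (normalsThrough O F) = F := by
  refine Set.Subset.antisymm ?_ fun x hx => ⟨hF.subset hx, fun u hu => hu.2 hx⟩
  obtain ⟨w, hFw⟩ := hF
  have hw := hO.mem_normalSpan_normalsThrough hFw
  rintro x ⟨hx, hxF⟩
  rw [hFw.2.1]
  refine ⟨hx, (lor_comm x.1 w.1).trans (lor_eq_zero_of_mem_span hw ?_)⟩
  rintro _ ⟨u, hu, rfl⟩
  exact (lor_comm u.1 x.1).trans (hxF u hu)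

theorem normal_mem_linearSpan_stratum {x : H3} {S : Set Normal} (hx : x ∈ stratum O S)
    (hS : S ⊆ O) {z : Normal} (hz : z ∈ O) (hxz : x ∈ plane z) (hzS : z ∉ S) :
    z.1 ∈ linearSpan (stratum O S) := by
  have horth : ∀ u ∈ O, x ∈ plane u → z ≠ u → lor z.1 u.1 = 0 := fun u hu hxu hzu =>
    hO.lor_eq_zero_of_mem_plane hz hu hzu hxz hxu
  have hmem : -z.1 ∈ linearSpan (stratum O S) := by
    refine hO.mem_linearSpan_stratum hx ?_ (fun u hu hxu => ?_) fun u hu => ?_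
    · rw [lor_neg_left, lor_comm, show lor x.1 z.1 = 0 from hxz, neg_zero]
    · rcases eq_or_ne z u with rfl | hzu
      · rw [lor_neg_left, z.2]
        norm_num
      · rw [lor_neg_left, horth u hu hxu hzu, neg_zero]
    · rw [lor_neg_left, horth u (hS hu) (hx.2 u hu) (ne_of_mem_of_not_mem hu hzS).symm, neg_zero]
  simpa using hmem

theorem orthogonal_linearSpan_stratum_le {x : H3} {S : Set Normal} (hx : x ∈ stratum O S) :
    lorForm.orthogonal (linearSpan (stratum O S)) ≤
      linearSpan {x} ⊔ normalSpan S ⊔ normalSpan (normalsThrough O {x} \ S) := by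
  set T := linearSpan {x} ⊔ normalSpan S ⊔ normalSpan (normalsThrough O {x} \ S)
  rw [← LinearMap.BilinForm.orthogonal_orthogonal lorForm_nondegenerate lorForm_isRefl T]
  refine LinearMap.BilinForm.orthogonal_le fun t ht => ?_
  have htT : ∀ y ∈ T, lor t y = 0 := fun y hy =>
    (lor_comm t y).trans (LinearMap.BilinForm.mem_orthogonal_iff.1 ht y hy)
  have htS : ∀ u ∈ S, lor t u.1 = 0 := fun u hu => htT u.1
    (Submodule.mem_sup_left (Submodule.mem_sup_right (Submodule.subset_span ⟨u, hu, rfl⟩)))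
  have htx : lor t x.1 = 0 :=
    htT x.1 (Submodule.mem_sup_left (Submodule.mem_sup_left (mem_linearSpan rfl)))
  refine hO.mem_linearSpan_stratum hx htx (fun u hu hxu => le_of_eq ?_) htS
  by_cases huS : u ∈ S
  · exact htS u huS
  · exact htT u.1 (Submodule.mem_sup_right
      (Submodule.subset_span ⟨u, ⟨⟨hu, Set.singleton_subset_iff.2 hxu⟩, huS⟩, rfl⟩))

theorem orthogonal_normalSpan_le {x : H3} {S : Set Normal} (hx : x ∈ stratum O S) (hS : S ⊆ O) :
    lorForm.orthogonal (normalSpan S) ≤ linearSpan (stratum O S) := by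
  rw [← LinearMap.BilinForm.orthogonal_orthogonal lorForm_nondegenerate lorForm_isRefl
    (linearSpan (stratum O S))]
  refine LinearMap.BilinForm.orthogonal_le fun w hw => ?_
  obtain ⟨z, hz, r, hr, rfl⟩ := Submodule.mem_sup.1 (hO.orthogonal_linearSpan_stratum_le hx hw)
  obtain ⟨a, ha, s, hs, rfl⟩ := Submodule.mem_sup.1 hz
  rw [linearSpan_singleton] at ha
  obtain ⟨c, rfl⟩ := Submodule.mem_span_singleton.1 ha
  have hw_perp : ∀ y ∈ linearSpan (stratum O S), lor y (c • x.1 + s + r) = 0 := fun y hy =>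
    LinearMap.BilinForm.mem_orthogonal_iff.1 hw y hy
  have hsx : lor s x.1 = 0 := lor_eq_zero_of_mem_span hs (by
    rintro _ ⟨u, hu, rfl⟩
    exact (lor_comm u.1 x.1).trans (hx.2 u hu))
  have hrx : lor r x.1 = 0 := lor_eq_zero_of_mem_span hr (by
    rintro _ ⟨u, hu, rfl⟩
    exact (lor_comm u.1 x.1).trans (hu.1.2 rfl))
  have hsr : lor r s = 0 := lor_eq_zero_of_mem_span hr (by
    rintro _ ⟨u, hu, rfl⟩
    refine (lor_comm u.1 s).trans (lor_eq_zero_of_mem_span hs ?_)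
    rintro _ ⟨v, hv, rfl⟩
    exact hO.lor_eq_zero_of_mem_plane (hS hv) hu.1.1 (ne_of_mem_of_not_mem hv hu.2) (hx.2 v hv)
      (hu.1.2 rfl))
  have hrr : lor r r = 0 := by
    have hrL : r ∈ linearSpan (stratum O S) := by
      refine Submodule.span_le.2 ?_ hr
      rintro _ ⟨u, hu, rfl⟩
      exact hO.normal_mem_linearSpan_stratum hx hS hu.1.1 (hu.1.2 rfl) hu.2
    simpa [hrx, hsr] using hw_perp r hrL
  have hr0 : r = 0 := by
    by_contra hne
    exact (lor_self_pos_of_lor_eq_zero (by simp [x.2.1]) hrx hne).ne' hrr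
  have hc : c = 0 := by
    simpa [hr0, lor_comm x.1 s, hsx, x.2.1] using hw_perp x.1 (mem_linearSpan hx)
  rwa [hc, hr0, zero_smul, zero_add, add_zero]

theorem linearSpan_stratum {x : H3} {S : Set Normal} (hx : x ∈ stratum O S) (hS : S ⊆ O) :
    linearSpan (stratum O S) = lorForm.orthogonal (normalSpan S) := by
  refine le_antisymm (Submodule.span_le.2 ?_) (hO.orthogonal_normalSpan_le hx hS)
  rintro _ ⟨y, hy, rfl⟩
  refine LinearMap.BilinForm.mem_orthogonal_iff.2 fun n hn => lor_eq_zero_of_mem_span hn ?_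
  rintro _ ⟨u, hu, rfl⟩
  exact (lor_comm u.1 y.1).trans (hy.2 u hu)

end RightAngled

theorem exists_normal_eq_smul_sum {S : Finset Normal} (hne : S.Nonempty)
    (hS : (S : Set Normal).Pairwise fun u v => lor u.1 v.1 = 0) :
    ∃ w : Normal, ∃ c : ℝ, 0 < c ∧ w.1 = c • ∑ u ∈ S, u.1 := by
  have hsum : ∀ v ∈ S, lor (∑ u ∈ S, u.1) v.1 = 1 := fun v hv => by
    rw [lor_sum_left, Finset.sum_eq_single v (fun u hu huv => hS hu hv huv) (absurd hv), v.2]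
  have hnorm : lor (∑ u ∈ S, u.1) (∑ u ∈ S, u.1) = S.card := by
    rw [lor_sum_left, Finset.sum_congr rfl fun v hv => (lor_comm v.1 _).trans (hsum v hv)]
    simp
  have hcard : (0 : ℝ) < S.card := Nat.cast_pos.2 hne.card_pos
  refine ⟨⟨(√S.card)⁻¹ • ∑ u ∈ S, u.1, ?_⟩, (√S.card)⁻¹, by positivity, rfl⟩
  rw [lor_smul_left, lor_smul_right, hnorm, ← mul_assoc, ← mul_inv, Real.mul_self_sqrt hcard.le,
    inv_mul_cancel₀ hcard.ne']

theorem smul_cell (g : isometryGroup) (O : Set Normal) : g • cell O = cell (g • O) := by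
  ext x
  rw [Set.mem_smul_set_iff_inv_smul_mem, mem_cell, mem_cell, ← Set.image_smul,
    Set.forall_mem_image]
  exact forall₂_congr fun u _ => iff_of_eq (congrArg (· ≤ 0) (lor_inv_isometry_smul g x.1 u.1))

namespace RightAngled

variable {O : Set Normal} {b : H3} (hO : RightAngled O b)
include hO

theorem pairwise_of_mem_stratum {x : H3} {S : Set Normal} (hx : x ∈ stratum O S) (hS : S ⊆ O) :
    S.Pairwise fun u v => lor u.1 v.1 = 0 := fun u hu v hv huv =>
  hO.lor_eq_zero_of_mem_plane (hS hu) (hS hv) huv (hx.2 u hu) (hx.2 v hv)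

theorem finrank_linearSpan_stratum {x : H3} {S : Set Normal} (hx : x ∈ stratum O S)
    (hS : S ⊆ O) : Module.finrank ℝ (linearSpan (stratum O S)) = 4 - S.ncard := by
  rw [hO.linearSpan_stratum hx hS, LinearMap.BilinForm.finrank_orthogonal lorForm_nondegenerate,
    Module.finrank_fin_fun, (finrank_normalSpan (hO.pairwise_of_mem_stratum hx hS)).2]

theorem isFace_stratum {k : ℕ} {x : H3} {S : Set Normal} (hx : x ∈ stratum O S) (hS : S ⊆ O)
    (hcard : S.ncard + k = 3) (hne : S.Nonempty) : IsFace k (cell O) (stratum O S) := by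
  have hpairwise := hO.pairwise_of_mem_stratum hx hS
  lift S to Finset Normal using (finrank_normalSpan hpairwise).1
  obtain ⟨w, c, hc, hw⟩ := exists_normal_eq_smul_sum (Finset.coe_nonempty.1 hne) hpairwise
  have hlor (y : H3) : lor y.1 w.1 = c * ∑ u ∈ S, lor y.1 u.1 := by
    rw [hw, lor_smul_right, lor_comm, lor_sum_left]
    simp only [lor_comm y.1]
  have hnonpos {y : H3} (hy : y ∈ cell O) : ∀ u ∈ S, lor y.1 u.1 ≤ 0 := fun u hu =>
    mem_cell.1 hy u (hS hu)
  refine ⟨w, fun y hy => ?_, ?_, ?_⟩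
  · exact (hlor y).trans_le
      (mul_nonpos_of_nonneg_of_nonpos hc.le (Finset.sum_nonpos (hnonpos hy)))
  · ext y
    refine and_congr_right fun hy => ?_
    rw [plane, Set.mem_ofPred_eq, hlor, mul_eq_zero, or_iff_right hc.ne',
      Finset.sum_eq_zero_iff_of_nonpos (hnonpos hy)]
    rfl
  · exact (hO.finrank_linearSpan_stratum hx hS).trans (by omega)

theorem normalsThrough_stratum {x : H3} {S : Set Normal} (hx : x ∈ stratum O S) (hS : S ⊆ O)
    (hcard : S.ncard ≤ 3) (hne : S.Nonempty) : normalsThrough O (stratum O S) = S := by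
  have hF := hO.isFace_stratum hx hS (Nat.add_sub_cancel' hcard) hne
  have hfinite := (finrank_normalSpan (hO.pairwise_normalsThrough hF.nonempty)).1
  have hsubset : S ⊆ normalsThrough O (stratum O S) := fun u hu => ⟨hS hu, fun y hy => hy.2 u hu⟩
  refine (Set.eq_of_subset_of_ncard_le hsubset ?_ hfinite).symm
  rw [hO.ncard_normalsThrough hF]
  omega

theorem ncard_setOf_isFace {k : ℕ} (hk : k < 3) {p : H3} (hp : IsFace 0 (cell O) {p}) :
    {F | IsFace k (cell O) F ∧ p ∈ F}.ncard = Nat.choose 3 (3 - k) := by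
  have hfinite := (finrank_normalSpan (hO.pairwise_normalsThrough hp.nonempty)).1
  have hstratum : ∀ S ∈ {S | S ⊆ normalsThrough O {p} ∧ S.ncard = 3 - k},
      p ∈ stratum O S ∧ S ⊆ O ∧ S.Nonempty := by
    rintro S ⟨hS, hcard⟩
    exact ⟨⟨hp.subset rfl, fun u hu => (hS hu).2 rfl⟩, fun u hu => (hS hu).1,
      Set.nonempty_of_ncard_ne_zero (by omega)⟩
  have hbij : Set.BijOn (stratum O) {S | S ⊆ normalsThrough O {p} ∧ S.ncard = 3 - k}
      {F | IsFace k (cell O) F ∧ p ∈ F} := by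
    refine Set.InvOn.bijOn (f' := normalsThrough O) ⟨fun S hS => ?_, fun F hF => ?_⟩
      (fun S hS => ?_) fun F hF => ?_
    · obtain ⟨hpS, hSO, hne⟩ := hstratum S hS
      exact hO.normalsThrough_stratum hpS hSO (hS.2.trans_le (Nat.sub_le 3 k)) hne
    · exact hO.stratum_normalsThrough hF.1
    · obtain ⟨hpS, hSO, hne⟩ := hstratum S hS
      exact ⟨hO.isFace_stratum hpS hSO (by rw [hS.2]; omega) hne, hpS⟩
    · exact ⟨fun u hu => ⟨hu.1, Set.singleton_subset_iff.2 (hu.2 hF.2)⟩,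
        hO.ncard_normalsThrough hF.1⟩
  rw [← hbij.image_eq, hbij.injOn.ncard_image, Set.ncard_powerset_ncard hfinite,
    hO.ncard_normalsThrough hp]

theorem isFace_two {u : Normal} (hu : u ∈ O) (hne : (cell O ∩ plane u).Nonempty) :
    IsFace 2 (cell O) (cell O ∩ plane u) := by
  obtain ⟨x, hx⟩ := hne
  rw [← stratum_singleton] at hx ⊢
  exact hO.isFace_stratum hx (Set.singleton_subset_iff.2 hu) (by simp) (Set.singleton_nonempty u)

theorem isFace_one_inter {u v : Normal} (hu : u ∈ O) (hv : v ∈ O) (huv : u ≠ v)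
    (hne : (cell O ∩ plane u ∩ plane v).Nonempty) :
    IsFace 1 (cell O ∩ plane u) (cell O ∩ plane u ∩ plane v) := by
  obtain ⟨x, hx⟩ := hne
  refine ⟨v, Set.inter_subset_left.trans (cell_subset_halfSpace hv), rfl, ?_⟩
  rw [← stratum_pair] at hx ⊢
  rw [hO.finrank_linearSpan_stratum hx (Set.pair_subset hu hv), Set.ncard_pair huv]

theorem normal_mem {F : Set H3} {w : Normal} (hF : IsFaceWithNormal 2 (cell O) F w) : w ∈ O := by
  obtain ⟨u, hu⟩ := Set.ncard_eq_one.1 (hO.ncard_normalsThrough ⟨w, hF⟩)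
  have huO : u ∈ O := (hu.ge rfl).1
  have hw := hO.mem_normalSpan_normalsThrough hF
  rw [hu, normalSpan, Set.image_singleton] at hw
  obtain ⟨c, hc⟩ := Submodule.mem_span_singleton.1 hw
  have hb : b ∈ cell O := mem_cell.2 fun v hv => (hO.lor_base_neg v hv).le
  have hbw : lor b.1 w.1 ≤ 0 := hF.1 hb
  have hbu := hO.lor_base_neg u huO
  have hww := w.2
  rw [← hc, lor_smul_right] at hbw
  rw [← hc, lor_smul_left, lor_smul_right, u.2] at hww
  have hc1 : c = 1 := by
    nlinarith [nonneg_of_mul_nonpos_left hbw hbu]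
  rwa [show w = u from Subtype.ext (by rw [← hc, hc1, one_smul])]

end RightAngled

theorem isConvex_hull (s : Set H3) : IsConvex (hull s) :=
  fun x hx y hy _ hz K hK => hK.1 x (hx K hK) y (hy K hK) hz

theorem subset_hull (s : Set H3) : s ⊆ hull s := fun _ hx _ hK => hK.2 hx

theorem hull_subset {s K : Set H3} (hK : IsConvex K) (hs : s ⊆ K) : hull s ⊆ K :=
  fun _ hx => hx K ⟨hK, hs⟩

theorem IsConvex.mem_of_eq_sum {K : Set H3} (hK : IsConvex K) {ι : Type*} {s : Finset ι}
    {r : ι → ℝ} {y : ι → H3} (hr : ∀ i ∈ s, 0 ≤ r i) (hy : ∀ i ∈ s, y i ∈ K) {x : H3}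
    (hx : x.1 = ∑ i ∈ s, r i • (y i).1) : x ∈ K := by
  classical
  have hx' : x.1 = ∑ i ∈ s with r i ≠ 0, r i • (y i).1 := by
    rw [hx, Finset.sum_filter_of_ne]
    exact fun i _ h h0 => h (by rw [h0, zero_smul])
  have hne : (s.filter fun i => r i ≠ 0).Nonempty := by
    rw [Finset.nonempty_iff_ne_empty]
    intro h
    rw [h, Finset.sum_empty] at hx'
    exact x.ne_zero hx'
  refine mem_of_mem_cone (hx' ▸ hK.sum_mem_cone hne fun i hi => ?_)
  obtain ⟨his, hi0⟩ := Finset.mem_filter.1 hi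
  exact smul_mem_cone (mem_cone_of_mem (hy i his)) ((hr i his).lt_of_ne' hi0)

/-- The centre of the model of hyperbolic space, which is also the centre of the polygon. -/
def origin : H3 := ⟨![1, 0, 0, 0], by simp [lor]⟩

section Polygon

variable (n : ℕ)

/-- Half of the central angle of a side of a regular `n`-gon. -/
def theta : ℝ := Real.pi / n

/-- The length of the spatial part of the unit normals of the sides of the regular right-angled
`n`-gon centred at `origin`. -/
def normB : ℝ := 1 / (√2 * Real.sin (theta n))

/-- The time component of the unit normals of the sides of the regular right-angled `n`-gon centred
at `origin`. -/
def normA : ℝ := √(normB n ^ 2 - 1)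

variable [hn : Fact (5 ≤ n)]

theorem natCast_pos : (0 : ℝ) < n := by exact_mod_cast (by norm_num : 0 < 5).trans_le hn.out

theorem mul_theta : (n : ℝ) * theta n = Real.pi := mul_div_cancel₀ _ (natCast_pos n).ne'

theorem theta_pos : 0 < theta n := div_pos Real.pi_pos (natCast_pos n)

theorem theta_lt_pi_div_four : theta n < Real.pi / 4 :=
  div_lt_div_of_pos_left Real.pi_pos (by norm_num)
    (by exact_mod_cast (by norm_num : 4 < 5).trans_le hn.out)

theorem sin_theta_pos : 0 < Real.sin (theta n) :=
  Real.sin_pos_of_pos_of_lt_pi (theta_pos n) (by linarith [theta_lt_pi_div_four n, Real.pi_pos])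

theorem cos_theta_pos : 0 < Real.cos (theta n) :=
  Real.cos_pos_of_mem_Ioo ⟨by linarith [theta_pos n, Real.pi_pos],
    by linarith [theta_lt_pi_div_four n, Real.pi_pos]⟩

theorem cos_two_mul_theta_pos : 0 < Real.cos (2 * theta n) :=
  Real.cos_pos_of_mem_Ioo ⟨by linarith [theta_pos n, Real.pi_pos],
    by linarith [theta_lt_pi_div_four n]⟩

theorem sin_two_mul_theta_pos : 0 < Real.sin (2 * theta n) := by
  have := sin_theta_pos n
  have := cos_theta_pos n
  rw [Real.sin_two_mul]
  positivity

theorem cos_two_mul_theta_lt_one : Real.cos (2 * theta n) < 1 := by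
  rw [Real.cos_two_mul']
  nlinarith [Real.sin_sq_add_cos_sq (theta n), sin_theta_pos n]

theorem normB_pos : 0 < normB n := by
  have := sin_theta_pos n
  rw [normB]
  positivity

theorem normB_sq_mul_sin_sq : 2 * normB n ^ 2 * Real.sin (theta n) ^ 2 = 1 := by
  have := sin_theta_pos n
  rw [normB, div_pow, mul_pow, Real.sq_sqrt zero_le_two]
  field_simp

theorem normB_sq_mul_cos_sq : 2 * normB n ^ 2 * Real.cos (theta n) ^ 2 = 2 * normB n ^ 2 - 1 := by
  rw [Real.cos_sq', mul_sub, normB_sq_mul_sin_sq, mul_one]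

theorem one_lt_normB_sq : 1 < normB n ^ 2 := by
  have hcos := cos_two_mul_theta_pos n
  rw [Real.cos_two_mul'] at hcos
  nlinarith [normB_sq_mul_sin_sq n, normB_sq_mul_cos_sq n, normB_pos n,
    mul_pos (pow_pos (normB_pos n) 2) hcos]

theorem normA_sq : normA n ^ 2 = normB n ^ 2 - 1 := Real.sq_sqrt (by linarith [one_lt_normB_sq n])

theorem normA_pos : 0 < normA n := Real.sqrt_pos.2 (by linarith [one_lt_normB_sq n])

theorem sin_add_mul_theta (m q : ℤ) :
    Real.sin (((m + n * q : ℤ) : ℝ) * theta n) = (-1) ^ q * Real.sin (m * theta n) := by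
  rw [← Real.sin_add_int_mul_pi, ← mul_theta n]
  congr 1
  push_cast
  ring

theorem sin_mul_theta_nonneg {r : ℤ} (h0 : 0 ≤ r) (hr : r ≤ n) : 0 ≤ Real.sin (r * theta n) := by
  have hθ := (theta_pos n).le
  refine Real.sin_nonneg_of_nonneg_of_le_pi (mul_nonneg (by exact_mod_cast h0) hθ) ?_
  rw [← mul_theta n]
  exact mul_le_mul_of_nonneg_right (by exact_mod_cast hr) hθ

theorem sin_mul_theta_mul_nonneg (m a b : ℤ) (ha : 0 ≤ m % n + a) (ha' : m % n + a ≤ n)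
    (hb : 0 ≤ m % n + b) (hb' : m % n + b ≤ n) :
    0 ≤ Real.sin ((m + a : ℤ) * theta n) * Real.sin ((m + b : ℤ) * theta n) := by
  have hsign : ((-1 : ℝ) ^ (m / n)) * (-1) ^ (m / n) = 1 := by rw [← mul_zpow]; simp
  rw [← Int.emod_add_mul_ediv m n, add_right_comm, add_right_comm _ _ b,
    sin_add_mul_theta, sin_add_mul_theta, mul_mul_mul_comm, hsign, one_mul]
  exact mul_nonneg (sin_mul_theta_nonneg n ha ha') (sin_mul_theta_nonneg n hb hb')

theorem dvd_of_sin_mul_theta_eq_zero {m : ℤ} (h : Real.sin (m * theta n) = 0) : (n : ℤ) ∣ m := by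
  obtain ⟨q, hq⟩ := Real.sin_eq_zero_iff.1 h
  rw [← mul_theta n, ← mul_assoc] at hq
  exact Dvd.intro_left q (by exact_mod_cast mul_right_cancel₀ (theta_pos n).ne' hq)

theorem cos_odd_mul_theta_le (m : ℤ) : Real.cos ((2 * m + 1) * theta n) ≤ Real.cos (theta n) := by
  have hdiff : Real.cos (theta n) - Real.cos ((2 * m + 1) * theta n) =
      2 * (Real.sin ((m + 0 : ℤ) * theta n) * Real.sin ((m + 1 : ℤ) * theta n)) := by
    rw [Real.cos_sub_cos,
      show (theta n + (2 * m + 1) * theta n) / 2 = (m + 1 : ℤ) * theta n by push_cast; ring,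
      show (theta n - (2 * m + 1) * theta n) / 2 = -((m + 0 : ℤ) * theta n) by push_cast; ring,
      Real.sin_neg]
    ring
  have hpos : (0 : ℤ) < n := by exact_mod_cast natCast_pos n
  have h0 := Int.emod_nonneg m hpos.ne'
  have hn := Int.emod_lt_of_pos m hpos
  linarith [sin_mul_theta_mul_nonneg n m 0 1 (by omega) (by omega) (by omega) (by omega)]

theorem cos_even_mul_theta_le {m : ℤ} (h0 : ¬ (n : ℤ) ∣ m) (h1 : ¬ (n : ℤ) ∣ m - 1)
    (h2 : ¬ (n : ℤ) ∣ m + 1) : Real.cos (2 * m * theta n) ≤ Real.cos (4 * theta n) := by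
  have hdiff : Real.cos (4 * theta n) - Real.cos (2 * m * theta n) =
      2 * (Real.sin ((m + -2 : ℤ) * theta n) * Real.sin ((m + 2 : ℤ) * theta n)) := by
    rw [Real.cos_sub_cos,
      show (4 * theta n + 2 * m * theta n) / 2 = (m + 2 : ℤ) * theta n by push_cast; ring,
      show (4 * theta n - 2 * m * theta n) / 2 = -((m + -2 : ℤ) * theta n) by push_cast; ring,
      Real.sin_neg]
    ring
  have hpos : (0 : ℤ) < n := by exact_mod_cast natCast_pos n
  have hr := Int.emod_nonneg m hpos.ne'
  have hrn := Int.emod_lt_of_pos m hpos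
  have hr0 : m % n ≠ 0 := fun h => h0 (Int.dvd_of_emod_eq_zero h)
  have hr1 : m % n ≠ 1 := fun h => h1 ⟨m / n, by linarith [Int.emod_add_mul_ediv m n]⟩
  have hrn1 : m % n ≠ n - 1 := fun h => h2 ⟨m / n + 1, by linarith [Int.emod_add_mul_ediv m n]⟩
  linarith [sin_mul_theta_mul_nonneg n m (-2) 2 (by omega) (by omega) (by omega) (by omega)]

/-- The outward normal of the plane containing the polygon. -/
def faceNormal : Normal := ⟨![0, 0, 0, 1], by simp [lor]⟩

/-- The outward normals of the sides of the polygon, periodic in `k` with period `n`. -/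
def sideNormal (k : ℤ) : Normal :=
  ⟨![normA n, normB n * Real.cos (2 * k * theta n), normB n * Real.sin (2 * k * theta n), 0], by
    simp only [lor, Matrix.cons_val]
    linear_combination normB n ^ 2 * Real.sin_sq_add_cos_sq (2 * k * theta n) - normA_sq n⟩

/-- The vertices of the polygon, periodic in `k` with period `n`: `vertex n k` is the common end
point of the sides with normals `sideNormal n k` and `sideNormal n (k + 1)`. -/
def vertex (k : ℤ) : H3 :=
  ⟨![√2 * (normB n * Real.cos (theta n)), √2 * (normA n * Real.cos ((2 * k + 1) * theta n)),
      √2 * (normA n * Real.sin ((2 * k + 1) * theta n)), 0], by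
    constructor
    · have hsq := Real.sin_sq_add_cos_sq ((2 * k + 1) * theta n)
      simp only [lor, Matrix.cons_val]
      linear_combination (exp := 1) (-(normB n * Real.cos (theta n)) ^ 2 + normA n ^ 2) *
        Real.sq_sqrt zero_le_two + √2 ^ 2 * normA n ^ 2 * hsq + 2 * normA_sq n -
        normB_sq_mul_cos_sq n
    · have := normB_pos n
      have := cos_theta_pos n
      simp only [Matrix.cons_val]
      positivity⟩

theorem lor_faceNormal (x : Fin 4 → ℝ) : lor x faceNormal.1 = x 3 := by
  simp [lor, faceNormal]

theorem lor_origin_sideNormal (k : ℤ) : lor origin.1 (sideNormal n k).1 = -normA n := by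
  simp [lor, origin, sideNormal]

theorem lor_vertex_sideNormal (j k : ℤ) : lor (vertex n j).1 (sideNormal n k).1 =
    √2 * normA n * normB n *
      (Real.cos ((2 * (j - k : ℤ) + 1) * theta n) - Real.cos (theta n)) := by
  have e : (2 * ((j - k : ℤ) : ℝ) + 1) * theta n = (2 * j + 1) * theta n - 2 * k * theta n := by
    push_cast; ring
  rw [e, Real.cos_sub]
  simp only [lor, vertex, sideNormal, Matrix.cons_val]
  ring

theorem lor_vertex_vertex (j k : ℤ) : lor (vertex n j).1 (vertex n k).1 =
    -(2 * normB n ^ 2 - 1) + 2 * normA n ^ 2 * Real.cos (2 * (j - k : ℤ) * theta n) := by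
  have e : 2 * ((j - k : ℤ) : ℝ) * theta n = (2 * j + 1) * theta n - (2 * k + 1) * theta n := by
    push_cast; ring
  rw [e, Real.cos_sub, ← normB_sq_mul_cos_sq]
  simp only [lor, vertex, Matrix.cons_val]
  ring_nf
  rw [Real.sq_sqrt zero_le_two]
  ring

theorem sideNormal_emod (k : ℤ) : sideNormal n (k % n) = sideNormal n k := by
  have e : 2 * (k : ℝ) * theta n = 2 * (k % n : ℤ) * theta n + (k / n : ℤ) * (2 * Real.pi) := by
    conv_lhs => rw [← Int.emod_add_mul_ediv k n]
    rw [← mul_theta n]; push_cast; ring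
  ext1
  simp only [sideNormal, e, Real.cos_add_int_mul_two_pi, Real.sin_add_int_mul_two_pi]

theorem vertex_emod (k : ℤ) : vertex n (k % n) = vertex n k := by
  have e : (2 * (k : ℝ) + 1) * theta n =
      (2 * (k % n : ℤ) + 1) * theta n + (k / n : ℤ) * (2 * Real.pi) := by
    conv_lhs => rw [← Int.emod_add_mul_ediv k n]
    rw [← mul_theta n]; push_cast; ring
  ext1
  simp only [vertex, e, Real.cos_add_int_mul_two_pi, Real.sin_add_int_mul_two_pi]

theorem vertex_mem_plane_sideNormal (k : ℤ) : vertex n k ∈ plane (sideNormal n k) :=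
  (lor_vertex_sideNormal n k k).trans (by simp)

theorem vertex_sub_one_mem_plane_sideNormal (k : ℤ) :
    vertex n (k - 1) ∈ plane (sideNormal n k) := by
  refine (lor_vertex_sideNormal n (k - 1) k).trans ?_
  rw [show (2 * ((k - 1 - k : ℤ) : ℝ) + 1) * theta n = -theta n by push_cast; ring,
    Real.cos_neg, sub_self, mul_zero]

theorem dvd_sub_of_vertex_eq {j k : ℤ} (h : vertex n j = vertex n k) : (n : ℤ) ∣ j - k := by
  have hlor := lor_vertex_vertex n j k
  rw [h, (vertex n k).2.1, mul_assoc 2 ((j - k : ℤ) : ℝ), Real.cos_two_mul, Real.cos_sq'] at hlor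
  have hsin : (4 * normA n ^ 2) * Real.sin ((j - k : ℤ) * theta n) ^ 2 = 0 := by
    linear_combination hlor + 2 * normA_sq n
  have hA := normA_pos n
  exact dvd_of_sin_mul_theta_eq_zero n
    (pow_eq_zero_iff two_ne_zero |>.1 ((mul_eq_zero.1 hsin).resolve_left (by positivity)))

theorem vertex_sub_one_ne (k : ℤ) : vertex n (k - 1) ≠ vertex n k := by
  intro h
  have hdvd := Int.le_of_dvd one_pos (by simpa using dvd_sub_of_vertex_eq n h.symm)
  have := hn.out
  omega

theorem eq_zero_of_lor_sideNormal_eq_zero {d : Fin 4 → ℝ} (hd : d 3 = 0) (k : ℤ)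
    (hpred : lor d (sideNormal n (k - 1)).1 = 0) (hk : lor d (sideNormal n k).1 = 0)
    (hsucc : lor d (sideNormal n (k + 1)).1 = 0) : d = 0 := by
  have hA := normA_pos n
  have hB := normB_pos n
  have hs := sin_two_mul_theta_pos n
  set φ := 2 * k * theta n with hφ
  have e₁ : 2 * ((k - 1 : ℤ) : ℝ) * theta n = φ - 2 * theta n := by rw [hφ]; push_cast; ring
  have e₂ : 2 * ((k + 1 : ℤ) : ℝ) * theta n = φ + 2 * theta n := by rw [hφ]; push_cast; ring
  simp only [lor, sideNormal, Matrix.cons_val, e₁, e₂, ← hφ, Real.cos_sub, Real.cos_add,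
    Real.sin_sub, Real.sin_add] at hpred hk hsucc
  -- the components of `d` along the `k`-th apothem and orthogonal to it
  set p := d 1 * Real.cos φ + d 2 * Real.sin φ with hp
  set q := d 2 * Real.cos φ - d 1 * Real.sin φ with hq
  have hq0 : q = 0 := by
    have : (2 * normB n * Real.sin (2 * theta n)) * q = 0 := by
      rw [hq]; linear_combination hsucc - hpred
    exact (mul_eq_zero.1 this).resolve_left (by positivity)
  have hp0 : p = 0 := by
    have : (2 * normB n * (1 - Real.cos (2 * theta n))) * p = 0 := by
      rw [hp]; linear_combination 2 * hk - hsucc - hpred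
    have := sub_pos.2 (cos_two_mul_theta_lt_one n)
    exact (mul_eq_zero.1 ‹_ * p = 0›).resolve_left (by positivity)
  have hsc := Real.sin_sq_add_cos_sq φ
  have h0 : d 0 * normA n = 0 := by linear_combination -hk + normB n * (hp.symm.trans hp0)
  ext i
  fin_cases i
  · exact (mul_eq_zero.1 h0).resolve_right hA.ne'
  · change d 1 = 0
    linear_combination Real.cos φ * (hp.symm.trans hp0) -
      Real.sin φ * (hq.symm.trans hq0) - d 1 * hsc
  · change d 2 = 0
    linear_combination Real.sin φ * (hp.symm.trans hp0) +
      Real.cos φ * (hq.symm.trans hq0) - d 2 * hsc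
  · exact hd

theorem exists_eq_smul_vertex_add {x : Fin 4 → ℝ} (hx : x 3 = 0) (k : ℤ) :
    ∃ c : ℝ, 0 < c ∧ x =
      (c * (lor x (sideNormal n k).1 - lor x (sideNormal n (k + 1)).1)) • (vertex n (k - 1)).1 +
      (c * (lor x (sideNormal n k).1 - lor x (sideNormal n (k - 1)).1)) • (vertex n k).1 +
      (-lor x (sideNormal n k).1 / normA n) • origin.1 := by
  have hA := normA_pos n
  have hB := normB_pos n
  have hcos : 0 < Real.cos (theta n) - Real.cos (3 * theta n) := by
    have := mul_pos (sin_theta_pos n) (sin_two_mul_theta_pos n)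
    rw [Real.cos_sub_cos, show (theta n + 3 * theta n) / 2 = 2 * theta n by ring,
      show (theta n - 3 * theta n) / 2 = -theta n by ring, Real.sin_neg]
    linarith
  have h₁ : lor (vertex n k).1 (sideNormal n (k - 1)).1 =
      √2 * normA n * normB n * (Real.cos (3 * theta n) - Real.cos (theta n)) := by
    rw [lor_vertex_sideNormal, sub_sub_cancel]; norm_num
  have h₂ : lor (vertex n (k - 1)).1 (sideNormal n (k + 1)).1 =
      √2 * normA n * normB n * (Real.cos (3 * theta n) - Real.cos (theta n)) := by
    rw [lor_vertex_sideNormal, ← Real.cos_neg (3 * theta n)]; push_cast; ring_nf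
  have h₃ : lor (vertex n (k - 1)).1 (sideNormal n (k - 1)).1 = 0 :=
    vertex_mem_plane_sideNormal n (k - 1)
  have h₄ : lor (vertex n k).1 (sideNormal n (k + 1)).1 = 0 := by
    have := vertex_sub_one_mem_plane_sideNormal n (k + 1)
    rwa [add_sub_cancel_right] at this
  have h₅ : lor (vertex n (k - 1)).1 (sideNormal n k).1 = 0 :=
    vertex_sub_one_mem_plane_sideNormal n k
  have h₆ : lor (vertex n k).1 (sideNormal n k).1 = 0 := vertex_mem_plane_sideNormal n k
  refine ⟨(√2 * normA n * normB n * (Real.cos (theta n) - Real.cos (3 * theta n)))⁻¹,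
    by positivity, sub_eq_zero.1 (eq_zero_of_lor_sideNormal_eq_zero n ?_ k ?_ ?_ ?_)⟩
  · simp [hx, vertex, origin]
  all_goals
    simp only [lor_sub_left, lor_add_left, lor_smul_left, lor_origin_sideNormal, h₁, h₂, h₃, h₄,
      h₅, h₆]
    field_simp
    ring

theorem sum_cos_odd_mul_theta (φ : ℝ) :
    ∑ k ∈ Finset.range n, Real.cos ((2 * k + 1) * theta n + φ) = 0 := by
  have htelescope : ∀ k : ℕ, 2 * Real.sin (theta n) * Real.cos ((2 * k + 1) * theta n + φ) =
      Real.sin (2 * (k + 1 : ℕ) * theta n + φ) - Real.sin (2 * k * theta n + φ) := by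
    intro k
    rw [show 2 * ((k + 1 : ℕ) : ℝ) * theta n + φ = ((2 * k + 1) * theta n + φ) + theta n by
        push_cast; ring,
      show 2 * (k : ℝ) * theta n + φ = ((2 * k + 1) * theta n + φ) - theta n by ring,
      Real.sin_add, Real.sin_sub]
    ring
  have hsum : 2 * Real.sin (theta n) *
      ∑ k ∈ Finset.range n, Real.cos ((2 * k + 1) * theta n + φ) = 0 := by
    rw [Finset.mul_sum, Finset.sum_congr rfl fun k _ => htelescope k,
      Finset.sum_range_sub fun k : ℕ => Real.sin (2 * k * theta n + φ), mul_assoc, mul_theta,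
      add_comm, Real.sin_add_two_pi]
    simp
  have := sin_theta_pos n
  exact (mul_eq_zero.1 hsum).resolve_left (by positivity)

theorem sum_vertex : ∑ k ∈ Finset.range n, (vertex n k).1 =
    (n * (√2 * (normB n * Real.cos (theta n)))) • origin.1 := by
  have hcos := sum_cos_odd_mul_theta n 0
  have hsin := sum_cos_odd_mul_theta n (-(Real.pi / 2))
  simp only [add_zero, ← sub_eq_add_neg, Real.cos_sub_pi_div_two] at hcos hsin
  ext i
  rw [Finset.sum_apply]
  fin_cases i <;> simp [vertex, origin, ← Finset.mul_sum, hcos, hsin]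

/-- The regular right-angled polygon with vertices `vertex n k`, described by its sides. -/
def polygon : Set H3 := {x | x ∈ plane faceNormal ∧ ∀ k, x ∈ halfSpace (sideNormal n k)}

theorem isConvex_polygon : IsConvex (polygon n) := fun x hx y hy _ hz =>
  ⟨isConvex_plane _ x hx.1 y hy.1 hz, fun k => isConvex_halfSpace _ x (hx.2 k) y (hy.2 k) hz⟩

theorem apply_three_of_mem_polygon {x : H3} (hx : x ∈ polygon n) : x.1 3 = 0 :=
  (lor_faceNormal x.1).symm.trans hx.1

theorem vertex_mem_polygon (k : ℤ) : vertex n k ∈ polygon n := by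
  refine ⟨lor_faceNormal _, fun j => (lor_vertex_sideNormal n k j).trans_le ?_⟩
  have := normA_pos n
  have := normB_pos n
  exact mul_nonpos_of_nonneg_of_nonpos (by positivity)
    (by linarith [cos_odd_mul_theta_le n (k - j)])

theorem origin_mem_hull_vertex : origin ∈ hull (Set.range (vertex n)) := by
  have := natCast_pos n
  have := normB_pos n
  have := cos_theta_pos n
  have hP : 0 < (n : ℝ) * (√2 * (normB n * Real.cos (theta n))) := by positivity
  refine (isConvex_hull _).mem_of_eq_sum (s := Finset.range n) (y := fun k : ℕ => vertex n k)
    (fun _ _ => (inv_pos.2 hP).le) (fun k _ => subset_hull _ (Set.mem_range_self _)) ?_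
  rw [← Finset.smul_sum, sum_vertex, inv_smul_smul₀ hP.ne']

theorem exists_forall_lor_sideNormal_le (x : Fin 4 → ℝ) :
    ∃ j : ℤ, ∀ k : ℤ, lor x (sideNormal n k).1 ≤ lor x (sideNormal n j).1 := by
  have hpos : (0 : ℤ) < n := by exact_mod_cast natCast_pos n
  obtain ⟨j, -, hj⟩ := Finset.exists_max_image (Finset.Ico (0 : ℤ) n)
    (fun k => lor x (sideNormal n k).1) ⟨0, Finset.mem_Ico.2 ⟨le_rfl, hpos⟩⟩
  refine ⟨j, fun k => ?_⟩
  rw [← sideNormal_emod n k]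
  exact hj _ (Finset.mem_Ico.2 ⟨Int.emod_nonneg k hpos.ne', Int.emod_lt_of_pos k hpos⟩)

theorem polygon_eq_hull : polygon n = hull (Set.range (vertex n)) := by
  refine Set.Subset.antisymm (fun x hx => ?_)
    (hull_subset (isConvex_polygon n) (Set.range_subset_iff.2 (vertex_mem_polygon n)))
  -- the sector of the polygon that contains `x` belongs to the side closest to `x`
  obtain ⟨j, hj⟩ := exists_forall_lor_sideNormal_le n x.1
  obtain ⟨c, hc, hsum⟩ := exists_eq_smul_vertex_add n (apply_three_of_mem_polygon n hx) j
  have hxj : lor x.1 (sideNormal n j).1 ≤ 0 := hx.2 j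
  refine (isConvex_hull _).mem_of_eq_sum (s := Finset.univ)
    (r := ![_, _, _]) (y := ![vertex n (j - 1), vertex n j, origin]) ?_ ?_
    (by simpa [Fin.sum_univ_three] using hsum)
  · intro i _
    fin_cases i
    · exact mul_nonneg hc.le (sub_nonneg.2 (hj _))
    · exact mul_nonneg hc.le (sub_nonneg.2 (hj _))
    · exact div_nonneg (neg_nonneg.2 hxj) (normA_pos n).le
  · intro i _
    fin_cases i
    · exact subset_hull _ ⟨_, rfl⟩
    · exact subset_hull _ ⟨_, rfl⟩
    · exact origin_mem_hull_vertex n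

theorem polygon_inter_plane (k : ℤ) :
    polygon n ∩ plane (sideNormal n k) = segment (vertex n (k - 1)) (vertex n k) := by
  refine Set.Subset.antisymm ?_ ?_
  · rintro x ⟨hx, hxk : lor x.1 (sideNormal n k).1 = 0⟩
    obtain ⟨c, hc, hsum⟩ := exists_eq_smul_vertex_add n (apply_three_of_mem_polygon n hx) k
    rw [hxk, neg_zero, zero_div, zero_smul, add_zero, zero_sub, zero_sub] at hsum
    exact ⟨_, _, mul_nonneg hc.le (neg_nonneg.2 (hx.2 _)), mul_nonneg hc.le (neg_nonneg.2 (hx.2 _)),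
      hsum⟩
  · exact (isConvex_polygon n).inter (isConvex_plane _)
      _ ⟨vertex_mem_polygon n _, vertex_sub_one_mem_plane_sideNormal n k⟩
      _ ⟨vertex_mem_polygon n _, vertex_mem_plane_sideNormal n k⟩

theorem isFace_segment_vertex (k : ℤ) :
    IsFace 1 (polygon n) (segment (vertex n k) (vertex n (k + 1))) := by
  have hne := vertex_sub_one_ne n (k + 1)
  have hinter := polygon_inter_plane n (k + 1)
  rw [add_sub_cancel_right] at hne hinter
  exact ⟨sideNormal n (k + 1), fun _ hx => hx.2 _, hinter.symm, finrank_linearSpan_segment hne⟩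

theorem hdist_vertex (k : ℤ) :
    hdist (vertex n k) (vertex n (k + 1)) = hdist (vertex n 0) (vertex n 1) := by
  rw [hdist, hdist, lor_vertex_vertex, lor_vertex_vertex, sub_add_cancel_left, zero_sub]

theorem lor_toward (x p y : H3) :
    lor (toward p x) (toward p y) = lor x.1 y.1 + lor x.1 p.1 * lor p.1 y.1 := by
  simp [toward, p.2.1, lor_comm y.1 p.1]

theorem angle_vertex (k : ℤ) :
    angle (vertex n (k - 1)) (vertex n k) (vertex n (k + 1)) = Real.pi / 2 := by
  have horth : lor (toward (vertex n k) (vertex n (k - 1)))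
      (toward (vertex n k) (vertex n (k + 1))) = 0 := by
    rw [lor_toward, lor_vertex_vertex, lor_vertex_vertex, lor_vertex_vertex]
    push_cast
    rw [show 2 * ((k : ℝ) - 1 - (k + 1)) * theta n = -(2 * (2 * theta n)) by ring,
      show 2 * ((k : ℝ) - 1 - k) * theta n = -(2 * theta n) by ring,
      show 2 * ((k : ℝ) - (k + 1)) * theta n = -(2 * theta n) by ring, Real.cos_neg, Real.cos_neg,
      Real.cos_two_mul, Real.cos_two_mul, normA_sq]
    linear_combination (4 - 8 * Real.cos (theta n) ^ 2 + 4 * (2 * normB n ^ 2 *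
      Real.cos (theta n) ^ 2 - 2 * normB n ^ 2 + 1)) * normB_sq_mul_cos_sq n
  rw [angle, horth, zero_div, Real.arccos_zero]

/-- The vertices of the polygon, indexed by residue classes. -/
def cyclicVertex (i : ZMod n) : H3 := vertex n i.val

theorem cyclicVertex_intCast (k : ℤ) : cyclicVertex n (k : ZMod n) = vertex n k := by
  have : NeZero n := ⟨(by norm_num : 0 < 5).trans_le hn.out |>.ne'⟩
  rw [cyclicVertex, ZMod.val_intCast, vertex_emod]

theorem injective_cyclicVertex : Function.Injective (cyclicVertex n) := by
  intro i j hij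
  obtain ⟨i, rfl⟩ := ZMod.intCast_surjective i
  obtain ⟨j, rfl⟩ := ZMod.intCast_surjective j
  rw [cyclicVertex_intCast, cyclicVertex_intCast] at hij
  exact (ZMod.intCast_eq_intCast_iff_dvd_sub i j n).2 (dvd_sub_of_vertex_eq n hij.symm)

theorem range_cyclicVertex : Set.range (cyclicVertex n) = Set.range (vertex n) := by
  rw [← (ZMod.intCast_surjective (n := n)).range_comp]
  exact congrArg Set.range (funext (cyclicVertex_intCast n))

theorem isRegularRightAngledPolygon_polygon : IsRegularRightAngledPolygon n (polygon n) := by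
  have hsucc (k : ℤ) : cyclicVertex n ((k : ZMod n) + 1) = vertex n (k + 1) := by
    exact_mod_cast cyclicVertex_intCast n (k + 1)
  have hpred (k : ℤ) : cyclicVertex n ((k : ZMod n) - 1) = vertex n (k - 1) := by
    exact_mod_cast cyclicVertex_intCast n (k - 1)
  refine ⟨⟨faceNormal, fun x hx => hx.1⟩, cyclicVertex n, injective_cyclicVertex n,
    (polygon_eq_hull n).trans (congrArg hull (range_cyclicVertex n).symm), ?_,
    ⟨hdist (vertex n 0) (vertex n 1), ?_⟩, ?_⟩ <;> intro i <;>
    obtain ⟨k, rfl⟩ := ZMod.intCast_surjective i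
  · rw [hsucc, cyclicVertex_intCast]
    exact isFace_segment_vertex n k
  · rw [hsucc, cyclicVertex_intCast]
    exact hdist_vertex n k
  · rw [hsucc, hpred, cyclicVertex_intCast]
    exact angle_vertex n k

end Polygon

/-! ### The tiling -/

section Tiling

variable (n : ℕ) [hn : Fact (5 ≤ n)]

/-- The Coxeter matrix of the symmetry group of a tiling by regular `n`-gons, three at each
vertex. -/
def tilingMatrix : CoxeterMatrix (Fin 3) where
  M := !![1, n, 2; n, 1, 3; 2, 3, 1]
  isSymm := by ext i j; fin_cases i <;> fin_cases j <;> rfl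
  diagonal i := by fin_cases i <;> rfl
  off_diagonal i j h := by
    have := hn.out
    fin_cases i <;> fin_cases j <;> simp_all <;> omega

/-- The normals of the mirrors that generate the symmetry group of the tiling: the perpendicular
bisector of a side of the polygon, the bisector of an angle, and the plane that exchanges the plane
of the polygon with that of a neighbour. -/
def mirror : Fin 3 → Normal :=
  ![⟨![0, 0, -1, 0], by simp [lor]⟩,
    ⟨![0, -Real.sin (theta n), Real.cos (theta n), 0], by
      simp only [lor, Matrix.cons_val]
      linear_combination Real.sin_sq_add_cos_sq (theta n)⟩,
    ⟨(√2)⁻¹ • ![normA n, normB n, 0, -1], by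
      have hsq : √2 ^ 2 = (2 : ℝ) := Real.sq_sqrt zero_le_two
      rw [lor_smul_left, lor_smul_right]
      simp only [lor, Matrix.cons_val]
      field_simp
      linear_combination -normA_sq n - hsq⟩]

variable (x : Fin 4 → ℝ)

theorem lor_mirror_zero : lor x (mirror n 0).1 = -x 2 := by
  simp [lor, mirror]

theorem lor_mirror_one :
    lor x (mirror n 1).1 = -Real.sin (theta n) * x 1 + Real.cos (theta n) * x 2 := by
  simp only [lor, mirror, Matrix.cons_val]
  ring

theorem lor_mirror_two :
    lor x (mirror n 2).1 = (√2)⁻¹ * (-(normA n * x 0) + normB n * x 1 - x 3) := by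
  simp only [lor, mirror, Matrix.cons_val, Matrix.smul_cons, smul_eq_mul]
  ring

theorem reflection_mirror_zero_smul :
    reflection (mirror n 0) • x = ![x 0, x 1, -x 2, x 3] := by
  rw [reflection_smul, lor_mirror_zero]
  ext i
  fin_cases i <;> simp [mirror]
  ring

theorem reflection_mirror_one_smul :
    reflection (mirror n 1) • x = ![x 0,
      Real.cos (2 * theta n) * x 1 + Real.sin (2 * theta n) * x 2,
      Real.sin (2 * theta n) * x 1 - Real.cos (2 * theta n) * x 2, x 3] := by
  have h := Real.sin_sq_add_cos_sq (theta n)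
  rw [reflection_smul, lor_mirror_one, Real.sin_two_mul, Real.cos_two_mul']
  ext i
  fin_cases i <;> simp [mirror]
  · linear_combination -x 1 * h
  · linear_combination -x 2 * h

theorem reflection_mirror_two_smul : reflection (mirror n 2) • x =
    x - (-(normA n * x 0) + normB n * x 1 - x 3) • ![normA n, normB n, 0, -1] := by
  have hsq : 2 * ((√2)⁻¹ * (√2)⁻¹) = (1 : ℝ) := by
    rw [← mul_inv, Real.mul_self_sqrt zero_le_two, mul_inv_cancel₀ two_ne_zero]
  rw [reflection_smul, lor_mirror_two]
  simp only [mirror, Matrix.cons_val, smul_smul]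
  congr 2
  linear_combination (-(normA n * x 0) + normB n * x 1 - x 3) * hsq

theorem lor_mirror_one_mirror_two : lor (mirror n 1).1 (mirror n 2).1 = -(1 / 2) := by
  have hsin := (sin_theta_pos n).ne'
  rw [lor_mirror_two, normB]
  simp only [mirror, Matrix.cons_val]
  field_simp
  rw [Real.sq_sqrt zero_le_two]
  ring

theorem isCoxeterChamber_mirror : IsCoxeterChamber (tilingMatrix n) (mirror n) where
  ne_zero i j := by
    have := hn.out
    fin_cases i <;> fin_cases j <;> simp [tilingMatrix]
    all_goals omega
  lor_eq i j := by
    have hdiag (i : Fin 3) : lor (mirror n i).1 (mirror n i).1 =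
        -Real.cos (Real.pi / tilingMatrix n i i) := by
      rw [(tilingMatrix n).diagonal, (mirror n i).2]
      simp
    have h01 : lor (mirror n 0).1 (mirror n 1).1 = -Real.cos (Real.pi / n) := by
      rw [lor_mirror_one]
      simp [mirror, theta]
    have h02 : lor (mirror n 0).1 (mirror n 2).1 = -Real.cos (Real.pi / (2 : ℕ)) := by
      rw [lor_mirror_two]
      simp [mirror]
    have h12 : lor (mirror n 1).1 (mirror n 2).1 = -Real.cos (Real.pi / (3 : ℕ)) := by
      rw [lor_mirror_one_mirror_two]
      simp
    fin_cases i <;> fin_cases j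
    exacts [hdiag 0, h01, h02, (lor_comm _ _).trans h01, hdiag 1, h12, (lor_comm _ _).trans h02,
      (lor_comm _ _).trans h12, hdiag 2]

theorem reflection_mirror_zero_smul_sideNormal (k : ℤ) :
    reflection (mirror n 0) • sideNormal n k = sideNormal n (-k) := by
  ext1
  rw [Normal.coe_isometry_smul, reflection_mirror_zero_smul]
  simp [sideNormal]

theorem reflection_mirror_one_smul_sideNormal (k : ℤ) :
    reflection (mirror n 1) • sideNormal n k = sideNormal n (1 - k) := by
  have e : 2 * ((1 - k : ℤ) : ℝ) * theta n = 2 * theta n - 2 * k * theta n := by push_cast; ring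
  ext1
  rw [Normal.coe_isometry_smul, reflection_mirror_one_smul]
  simp only [sideNormal, e, Real.cos_sub, Real.sin_sub]
  ext i
  fin_cases i <;> simp <;> ring

theorem reflection_mirror_two_smul_faceNormal :
    reflection (mirror n 2) • faceNormal = sideNormal n 0 := by
  ext1
  rw [Normal.coe_isometry_smul, reflection_mirror_two_smul]
  ext i
  fin_cases i <;> simp [faceNormal, sideNormal]

theorem reflection_mirror_two_smul_sideNormal_zero :
    reflection (mirror n 2) • sideNormal n 0 = faceNormal := by
  ext1
  rw [Normal.coe_isometry_smul, reflection_mirror_two_smul]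
  ext i
  fin_cases i <;> simp [faceNormal, sideNormal]
  · linear_combination normA n * normA_sq n
  · linear_combination normB n * normA_sq n
  · linear_combination -normA_sq n

theorem reflection_mirror_two_smul_sideNormal_of_cos_eq {k : ℤ}
    (h : Real.cos (2 * k * theta n) = Real.cos (2 * theta n)) :
    reflection (mirror n 2) • sideNormal n k = sideNormal n k := by
  refine Subtype.ext (reflection_smul_of_mem_plane ?_)
  rw [lor_mirror_two]
  simp only [sideNormal, Matrix.cons_val, h, Real.cos_two_mul]
  linear_combination (√2)⁻¹ * (normB_sq_mul_cos_sq n - normA_sq n)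

theorem reflection_mirror_two_smul_sideNormal_le {k : ℤ} (h0 : ¬ (n : ℤ) ∣ k)
    (h1 : ¬ (n : ℤ) ∣ k - 1) (h2 : ¬ (n : ℤ) ∣ k + 1) :
    (reflection (mirror n 2) • (sideNormal n k).1) 3 ≤ -1 := by
  have happly : (reflection (mirror n 2) • (sideNormal n k).1) 3 =
      1 - normB n ^ 2 * (1 - Real.cos (2 * k * theta n)) := by
    rw [reflection_mirror_two_smul]
    simp only [sideNormal, Pi.sub_apply, Pi.smul_apply, Matrix.cons_val, smul_eq_mul]
    linear_combination -normA_sq n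
  have hcos := cos_two_mul_theta_pos n
  have hfour : normB n ^ 2 * (1 - Real.cos (4 * theta n)) = 4 * Real.cos (theta n) ^ 2 := by
    rw [show 4 * theta n = 2 * (2 * theta n) by ring, Real.cos_two_mul, Real.cos_two_mul]
    linear_combination -4 * Real.cos (theta n) ^ 2 * normB_sq_mul_cos_sq n
  have hle := mul_le_mul_of_nonneg_left (cos_even_mul_theta_le n h0 h1 h2) (sq_nonneg (normB n))
  rw [Real.cos_two_mul] at hcos
  linarith

/-- The unit normals of the plane of the polygon, of the planes orthogonal to it through the sides
of the polygon, and of the planes that do not cross the plane of the polygon. -/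
def baseCompatible : Set Normal :=
  {u | u = faceNormal ∨ u ∈ Set.range (sideNormal n) ∨ u.1 3 ≤ -1}

theorem reflection_mirror_zero_smul_mem_baseCompatible {u : Normal} (hu : u ∈ baseCompatible n) :
    reflection (mirror n 0) • u ∈ baseCompatible n := by
  rcases hu with rfl | ⟨k, rfl⟩ | hu
  · refine Or.inl (Subtype.ext (reflection_smul_of_mem_plane ?_))
    simp [lor_mirror_zero, faceNormal]
  · exact Or.inr (Or.inl ⟨_, (reflection_mirror_zero_smul_sideNormal n k).symm⟩)
  · refine Or.inr (Or.inr ?_)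
    rw [Normal.coe_isometry_smul, reflection_mirror_zero_smul]
    exact hu

theorem reflection_mirror_one_smul_mem_baseCompatible {u : Normal} (hu : u ∈ baseCompatible n) :
    reflection (mirror n 1) • u ∈ baseCompatible n := by
  rcases hu with rfl | ⟨k, rfl⟩ | hu
  · refine Or.inl (Subtype.ext (reflection_smul_of_mem_plane ?_))
    simp [lor_mirror_one, faceNormal]
  · exact Or.inr (Or.inl ⟨_, (reflection_mirror_one_smul_sideNormal n k).symm⟩)
  · refine Or.inr (Or.inr ?_)
    rw [Normal.coe_isometry_smul, reflection_mirror_one_smul]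
    exact hu

theorem reflection_mirror_two_smul_sideNormal_mem_baseCompatible (k : ℤ) :
    reflection (mirror n 2) • sideNormal n k ∈ baseCompatible n := by
  have hperiodic {j : ℤ} (h : (n : ℤ) ∣ k - j) : sideNormal n k = sideNormal n j := by
    rw [← sideNormal_emod n k, ← sideNormal_emod n j, (Int.modEq_iff_dvd.2 h).symm]
  by_cases h0 : (n : ℤ) ∣ k
  · rw [hperiodic (j := 0) (by simpa using h0)]
    exact Or.inl (reflection_mirror_two_smul_sideNormal_zero n)
  by_cases h1 : (n : ℤ) ∣ k - 1
  · rw [hperiodic h1]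
    exact Or.inr (Or.inl ⟨1, (reflection_mirror_two_smul_sideNormal_of_cos_eq n (by simp)).symm⟩)
  by_cases h2 : (n : ℤ) ∣ k + 1
  · rw [hperiodic (j := -1) (by simpa using h2)]
    exact Or.inr (Or.inl ⟨-1, (reflection_mirror_two_smul_sideNormal_of_cos_eq n (by simp)).symm⟩)
  exact Or.inr (Or.inr (reflection_mirror_two_smul_sideNormal_le n h0 h1 h2))

theorem reflection_mirror_two_smul_mem_baseCompatible {u : Normal} (hu : u ∈ baseCompatible n)
    (hle : lor u.1 (mirror n 2).1 ≤ 0) : reflection (mirror n 2) • u ∈ baseCompatible n := by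
  rcases hu with rfl | ⟨k, rfl⟩ | hu
  · exact Or.inr (Or.inl ⟨0, (reflection_mirror_two_smul_faceNormal n).symm⟩)
  · exact reflection_mirror_two_smul_sideNormal_mem_baseCompatible n k
  · refine Or.inr (Or.inr ?_)
    rw [lor_mirror_two] at hle
    have hle := nonpos_of_mul_nonpos_right hle (by positivity)
    rw [Normal.coe_isometry_smul, reflection_mirror_two_smul]
    simp only [Pi.sub_apply, Pi.smul_apply, Matrix.cons_val, smul_eq_mul]
    linarith

/-- The symmetry group of the tiling. -/
def tilingGroup : Subgroup isometryGroup :=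
  (isCoxeterChamber_mirror n).toIsometryGroup.range

theorem reflection_mem_tilingGroup (i : Fin 3) : reflection (mirror n i) ∈ tilingGroup n :=
  ⟨_, (isCoxeterChamber_mirror n).toIsometryGroup_simple i⟩

/-- The outward normals of the faces of the polyhedron. -/
def faceNormals : Set Normal := MulAction.orbit (tilingGroup n) faceNormal

theorem faceNormal_mem_faceNormals : faceNormal ∈ faceNormals n := MulAction.mem_orbit_self _

theorem smul_mem_faceNormals {g : isometryGroup} (hg : g ∈ tilingGroup n) {u : Normal}
    (hu : u ∈ faceNormals n) : g • u ∈ faceNormals n :=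
  MulAction.mem_orbit_of_mem_orbit (⟨g, hg⟩ : tilingGroup n) hu

theorem smul_faceNormals {g : isometryGroup} (hg : g ∈ tilingGroup n) :
    g • faceNormals n = faceNormals n :=
  MulAction.smul_orbit (⟨g, hg⟩ : tilingGroup n) faceNormal

theorem sideNormal_mem_faceNormals (k : ℤ) : sideNormal n k ∈ faceNormals n := by
  have hneg {k : ℤ} (hk : sideNormal n k ∈ faceNormals n) : sideNormal n (-k) ∈ faceNormals n := by
    rw [← reflection_mirror_zero_smul_sideNormal]
    exact smul_mem_faceNormals n (reflection_mem_tilingGroup n 0) hk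
  have hsub {k : ℤ} (hk : sideNormal n k ∈ faceNormals n) :
      sideNormal n (1 - k) ∈ faceNormals n := by
    rw [← reflection_mirror_one_smul_sideNormal]
    exact smul_mem_faceNormals n (reflection_mem_tilingGroup n 1) hk
  induction k with
  | zero =>
    rw [← reflection_mirror_two_smul_faceNormal]
    exact smul_mem_faceNormals n (reflection_mem_tilingGroup n 2) (faceNormal_mem_faceNormals n)
  | succ k ih => simpa [add_comm] using hsub (hneg ih)
  | pred k ih => simpa [sub_eq_add_neg] using hneg (hsub ih)

theorem faceNormals_subset {S : Set Normal} (hfaceNormal : faceNormal ∈ S)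
    (hS : ∀ i, ∀ u ∈ S, lor u.1 (mirror n i).1 ≤ 0 → reflection (mirror n i) • u ∈ S) :
    faceNormals n ⊆ S := by
  rintro _ ⟨⟨_, w, rfl⟩, rfl⟩
  refine (isCoxeterChamber_mirror n).smul_mem_of_forall_reflection_smul_mem hfaceNormal
    (fun i => ?_) hS w
  rw [lor_comm, lor_faceNormal]
  fin_cases i <;> simp [mirror]

theorem faceNormals_subset_baseCompatible : faceNormals n ⊆ baseCompatible n := by
  refine faceNormals_subset n (Or.inl rfl) fun i u hu hle => ?_
  fin_cases i
  · exact reflection_mirror_zero_smul_mem_baseCompatible n hu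
  · exact reflection_mirror_one_smul_mem_baseCompatible n hu
  · exact reflection_mirror_two_smul_mem_baseCompatible n hu hle

-- the symmetry group of the tiling fixes the vector `(1, 0, 0, -A)`
theorem apply_zero_of_mem_faceNormals {u : Normal} (hu : u ∈ faceNormals n) :
    u.1 0 = normA n * (1 - u.1 3) := by
  refine faceNormals_subset n (S := {u | u.1 0 = normA n * (1 - u.1 3)}) (by simp [faceNormal])
    (fun i u (hu : u.1 0 = _) _ => ?_) hu
  rw [Set.mem_ofPred_eq, Normal.coe_isometry_smul]
  fin_cases i
  · exact (reflection_mirror_zero_smul n u.1).symm ▸ hu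
  · exact (reflection_mirror_one_smul n u.1).symm ▸ hu
  · change (reflection (mirror n 2) • u.1) 0 = normA n * (1 - (reflection (mirror n 2) • u.1) 3)
    rw [reflection_mirror_two_smul]
    simp only [Pi.sub_apply, Pi.smul_apply, Matrix.cons_val, smul_eq_mul]
    linear_combination hu

/-- A point in the interior of the polyhedron. -/
def basePoint : H3 := ⟨![normB n, 0, 0, -normA n], by
  refine ⟨?_, normB_pos n⟩
  simp only [lor, Matrix.cons_val]
  linear_combination normA_sq n⟩

theorem apply_three_of_mem_faceNormals {u : Normal} (hu : u ∈ faceNormals n) :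
    u = faceNormal ∨ u.1 3 ≤ 0 := by
  rcases faceNormals_subset_baseCompatible n hu with rfl | ⟨k, rfl⟩ | h
  · exact Or.inl rfl
  · exact Or.inr (by simp [sideNormal])
  · exact Or.inr (by linarith)

theorem lor_basePoint_neg {u : Normal} (hu : u ∈ faceNormals n) :
    lor (basePoint n).1 u.1 < 0 := by
  have hA := normA_pos n
  have hB : 1 < normB n := (one_lt_sq_iff₀ (normB_pos n).le).1 (one_lt_normB_sq n)
  have hlor : lor (basePoint n).1 u.1 = -(normA n * (normB n * (1 - u.1 3) + u.1 3)) := by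
    rw [lor, apply_zero_of_mem_faceNormals n hu]
    simp only [basePoint, Matrix.cons_val]
    ring
  rw [hlor, neg_lt_zero]
  refine mul_pos hA ?_
  rcases apply_three_of_mem_faceNormals n hu with rfl | h
  · simp [faceNormal]
  · nlinarith

theorem rightAngled_faceNormals : RightAngled (faceNormals n) (basePoint n) where
  lor_eq_zero_or_le := by
    rintro _ ⟨⟨g, hg⟩, rfl⟩ v hv hne
    have hmem := smul_mem_faceNormals n (inv_mem hg) hv
    have hlor : lor (g • faceNormal).1 v.1 = (g⁻¹ • v).1 3 := by
      rw [← lor_faceNormal (g⁻¹ • v).1, Normal.coe_isometry_smul, Normal.coe_isometry_smul,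
        lor_inv_isometry_smul, lor_comm]
    change lor (g • faceNormal).1 v.1 = 0 ∨ lor (g • faceNormal).1 v.1 ≤ -1
    rw [hlor]
    rcases faceNormals_subset_baseCompatible n hmem with h | ⟨k, h⟩ | h
    · exact absurd (inv_smul_eq_iff.1 h).symm hne
    · exact Or.inl (by rw [← h]; rfl)
    · exact Or.inr h
  lor_base_neg _ := lor_basePoint_neg n

theorem lor_nonpos_of_apply_three_le {u : Normal} (hu : u ∈ faceNormals n) (h3 : u.1 3 ≤ -1)
    {x : H3} (hx : x ∈ plane faceNormal) : lor x.1 u.1 ≤ 0 := by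
  have hx3 : x.1 3 = 0 := (lor_faceNormal x.1).symm.trans hx
  -- the orthogonal projection of `u` to the span of the plane is causal
  set y := u.1 - u.1 3 • faceNormal.1 with hy
  have hxy : lor x.1 y = lor x.1 u.1 := by
    rw [hy, lor_sub_right, lor_smul_right, lor_faceNormal, hx3, mul_zero, sub_zero]
  have hyy : lor y y = 1 - u.1 3 ^ 2 := by
    simp only [hy, lor_sub_left, lor_sub_right, lor_smul_left, lor_smul_right, u.2, faceNormal.2,
      lor_comm faceNormal.1, lor_faceNormal u.1]
    ring
  have hy0 : y 0 = normA n * (1 - u.1 3) := by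
    rw [← apply_zero_of_mem_faceNormals n hu]
    rw [hy, Pi.sub_apply, Pi.smul_apply, show faceNormal.1 0 = 0 from rfl, smul_zero, sub_zero]
  rw [← hxy]
  exact (lor_neg_of_timelike_of_causal (by rw [x.2.1]; norm_num) x.2.2 (by rw [hyy]; nlinarith)
    (hy0 ▸ mul_pos (normA_pos n) (by linarith))).le

theorem cell_inter_plane_faceNormal : cell (faceNormals n) ∩ plane faceNormal = polygon n := by
  refine Set.Subset.antisymm (fun x hx => ⟨hx.2, fun k => ?_⟩) fun x hx => ⟨?_, hx.1⟩
  · exact cell_subset_halfSpace (sideNormal_mem_faceNormals n k) hx.1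
  · refine mem_cell.2 fun u hu => ?_
    rcases faceNormals_subset_baseCompatible n hu with rfl | ⟨k, rfl⟩ | h
    · exact hx.1.le
    · exact hx.2 k
    · exact lor_nonpos_of_apply_three_le n hu h hx.1

theorem isRegularRightAngledPolygon_cell_inter_plane {u : Normal} (hu : u ∈ faceNormals n) :
    IsRegularRightAngledPolygon n (cell (faceNormals n) ∩ plane u) := by
  obtain ⟨⟨g, hg⟩, rfl⟩ := hu
  have h : cell (faceNormals n) ∩ plane (g • faceNormal) = g • polygon n := by
    rw [← cell_inter_plane_faceNormal, Set.smul_set_inter, smul_cell, smul_plane,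
      smul_faceNormals n hg]
  exact h ▸ (isRegularRightAngledPolygon_polygon n).smul

end Tiling

/-! ### Volume -/

section Volume

open MeasureTheory

theorem lor_nonpos_of_lor_null_le {N : Fin 4 → ℝ} (hN : lor N N = 0) {x : H3} {u : Normal}
    (hx : lor x.1 N < 0) (hle : lor u.1 N ≤ lor x.1 N) : lor x.1 u.1 ≤ 0 := by
  have hux : lor u.1 x.1 = lor x.1 u.1 := lor_comm _ _
  obtain ⟨s, hs⟩ : ∃ s, lor x.1 N = -s := ⟨-lor x.1 N, (neg_neg _).symm⟩
  obtain ⟨r, hr⟩ : ∃ r, lor u.1 N = -r := ⟨-lor u.1 N, (neg_neg _).symm⟩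
  rw [hs, hr] at hle
  rw [hs] at hx
  -- the multiple by `s ^ 2` of the component of `u` orthogonal to `x` and `N`
  let p := s ^ 2 • u.1 + (s * lor x.1 u.1 + r) • N - (s * r) • x.1
  have hpx : lor p x.1 = 0 := by
    simp only [p, sub_eq_add_neg, lor_add_left, lor_neg_left, lor_smul_left, x.2.1, hux,
      lor_comm N x.1, hs]
    ring
  have hpp : lor p p = s ^ 2 * (s ^ 2 - r ^ 2 - 2 * (s * r) * lor x.1 u.1) := by
    simp only [p, sub_eq_add_neg, lor_add_left, lor_add_right, lor_neg_left, lor_neg_right,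
      lor_smul_left, lor_smul_right, x.2.1, u.2, hN, hux, lor_comm N x.1, lor_comm N u.1, hs, hr]
    ring
  have hnonneg : 0 ≤ s ^ 2 - r ^ 2 - 2 * (s * r) * lor x.1 u.1 := by
    have hpp_nonneg := lor_self_nonneg_of_lor_eq_zero (by simp [x.2.1]) hpx
    rw [hpp] at hpp_nonneg
    exact nonneg_of_mul_nonneg_right hpp_nonneg (by nlinarith)
  have hsr : 0 < s * r := mul_pos (by linarith) (by linarith)
  by_contra! hpos
  nlinarith [mul_pos hsr hpos]

/-- The horoball centred at the ideal point `(1, 0, 0, -1)` and tangent to `plane faceNormal` at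
`origin`. -/
def horoball : Set H3 := {x | x.1 0 + x.1 3 ≤ 1}

theorem apply_three_nonpos_of_mem_horoball {x : H3} (hx : x ∈ horoball) : x.1 3 ≤ 0 := by
  have hsq := lor_self_add_sq x.1
  rw [x.2.1] at hsq
  have hx0 : 1 ≤ x.1 0 := by
    nlinarith [x.2.2, sq_nonneg (x.1 1), sq_nonneg (x.1 2), sq_nonneg (x.1 3)]
  linarith [show x.1 0 + x.1 3 ≤ 1 from hx]

theorem one_le_normA {n : ℕ} (hn : 6 ≤ n) : 1 ≤ normA n := by
  have : Fact (5 ≤ n) := ⟨by omega⟩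
  have hsin : Real.sin (theta n) ≤ 1 / 2 := by
    rw [← Real.sin_pi_div_six]
    refine Real.sin_le_sin_of_le_of_le_pi_div_two (by linarith [theta_pos n, Real.pi_pos])
      (by linarith [Real.pi_pos]) ?_
    exact div_le_div_of_nonneg_left Real.pi_pos.le (by norm_num) (by exact_mod_cast hn)
  have hsin_sq : Real.sin (theta n) ^ 2 ≤ (1 / 2) ^ 2 :=
    pow_le_pow_left₀ (sin_theta_pos n).le hsin 2
  refine (sq_le_sq₀ zero_le_one (normA_pos n).le).1 ?_
  nlinarith [normA_sq n, normB_sq_mul_sin_sq n, sq_nonneg (normB n)]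

theorem horoball_subset_cell {n : ℕ} [Fact (5 ≤ n)] (hA : 1 ≤ normA n) :
    horoball ⊆ cell (faceNormals n) := by
  have hlor (z : Fin 4 → ℝ) : lor z ![1, 0, 0, -1] = -(z 0 + z 3) := by
    simp only [lor, Matrix.cons_val]
    ring
  intro x hx
  refine mem_cell.2 fun u hu => ?_
  rcases apply_three_of_mem_faceNormals n hu with rfl | hu3
  · exact (lor_faceNormal x.1).trans_le (apply_three_nonpos_of_mem_horoball hx)
  · refine lor_nonpos_of_lor_null_le (N := ![1, 0, 0, -1]) (by simp [lor])
      (lor_neg_of_timelike_of_causal (by simp [x.2.1]) x.2.2 (by simp [lor]) (by simp)) ?_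
    rw [hlor, hlor, neg_le_neg_iff, apply_zero_of_mem_faceNormals n hu]
    calc x.1 0 + x.1 3 ≤ 1 := hx
      _ ≤ normA n * (1 - u.1 3) + u.1 3 := by nlinarith

theorem measurable_lift : Measurable lift := by
  refine Measurable.subtype_mk (measurable_pi_iff.2 fun i => ?_)
  fin_cases i
  all_goals
    simp only [Fin.zero_eta, Fin.mk_one, Fin.reduceFinMk, Matrix.cons_val]
    fun_prop

theorem lintegral_le_hypVolume (S : Set H3) :
    ∫⁻ y in lift ⁻¹' S, ENNReal.ofReal (1 / √(1 + y 0 ^ 2 + y 1 ^ 2 + y 2 ^ 2)) ≤ hypVolume S :=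
  (withDensity_apply_le _ _).trans (Measure.le_map_apply measurable_lift.aemeasurable S)

/-- A box of Euclidean volume `m ^ 4` that `lift` maps into `horoball`, on which the hyperbolic
volume density is of order `m ^ (-2)`. -/
def horoballBox (m : ℝ) : Set (Fin 3 → ℝ) := Set.Icc ![0, 0, -(2 * m ^ 2)] ![m, m, -m ^ 2]

theorem mem_horoballBox {m : ℝ} {y : Fin 3 → ℝ} : y ∈ horoballBox m ↔
    (0 ≤ y 0 ∧ y 0 ≤ m) ∧ (0 ≤ y 1 ∧ y 1 ≤ m) ∧ -(2 * m ^ 2) ≤ y 2 ∧ y 2 ≤ -m ^ 2 := by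
  refine ⟨fun h => ⟨⟨h.1 0, h.2 0⟩, ⟨h.1 1, h.2 1⟩, h.1 2, h.2 2⟩,
    fun h => ⟨fun i => ?_, fun i => ?_⟩⟩
  · fin_cases i
    exacts [h.1.1, h.2.1.1, h.2.2.1]
  · fin_cases i
    exacts [h.1.2, h.2.1.2, h.2.2.2]

theorem volume_horoballBox {m : ℝ} (hm : 0 ≤ m) :
    volume (horoballBox m) = ENNReal.ofReal (m ^ 4) := by
  rw [horoballBox, Real.volume_Icc_pi, Fin.prod_univ_three]
  simp only [Matrix.cons_val, sub_zero]
  rw [← ENNReal.ofReal_mul hm, ← ENNReal.ofReal_mul (by positivity)]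
  congr 1
  ring

theorem horoballBox_subset {m : ℝ} (hm : 1 ≤ m) : horoballBox m ⊆ lift ⁻¹' horoball := by
  intro y hy
  obtain ⟨⟨h0, h0'⟩, ⟨h1, h1'⟩, -, h2'⟩ := mem_horoballBox.1 hy
  have hsqrt : √(1 + y 0 ^ 2 + y 1 ^ 2 + y 2 ^ 2) ≤ 1 - y 2 :=
    Real.sqrt_le_iff.2 ⟨by nlinarith, by nlinarith⟩
  exact le_sub_iff_add_le.1 hsqrt

theorem le_density_of_mem_horoballBox {m : ℝ} (hm : 1 ≤ m) {y : Fin 3 → ℝ}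
    (hy : y ∈ horoballBox m) :
    1 / (3 * m ^ 2) ≤ 1 / √(1 + y 0 ^ 2 + y 1 ^ 2 + y 2 ^ 2) := by
  obtain ⟨⟨h0, h0'⟩, ⟨h1, h1'⟩, h2, h2'⟩ := mem_horoballBox.1 hy
  have hm_sq : 1 ≤ m ^ 2 := one_le_pow₀ hm
  have hy2 : y 2 ^ 2 ≤ (2 * m ^ 2) ^ 2 := sq_le_sq' h2 (by linarith)
  refine one_div_le_one_div_of_le (Real.sqrt_pos.2 (by positivity))
    (Real.sqrt_le_iff.2 ⟨by positivity, ?_⟩)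
  nlinarith [pow_le_pow_left₀ h0 h0' 2, pow_le_pow_left₀ h1 h1' 2]

theorem le_hypVolume_horoball {m : ℝ} (hm : 1 ≤ m) :
    ENNReal.ofReal (m ^ 2 / 3) ≤ hypVolume horoball := by
  calc ENNReal.ofReal (m ^ 2 / 3)
      = ENNReal.ofReal (1 / (3 * m ^ 2)) * volume (horoballBox m) := by
        rw [volume_horoballBox (by positivity), ← ENNReal.ofReal_mul (by positivity)]
        congr 1
        field_simp
    _ = ∫⁻ _ in horoballBox m, ENNReal.ofReal (1 / (3 * m ^ 2)) := (setLIntegral_const _ _).symm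
    _ ≤ ∫⁻ y in horoballBox m, ENNReal.ofReal (1 / √(1 + y 0 ^ 2 + y 1 ^ 2 + y 2 ^ 2)) :=
        setLIntegral_mono' measurableSet_Icc fun y hy =>
          ENNReal.ofReal_le_ofReal (le_density_of_mem_horoballBox hm hy)
    _ ≤ ∫⁻ y in lift ⁻¹' horoball, ENNReal.ofReal (1 / √(1 + y 0 ^ 2 + y 1 ^ 2 + y 2 ^ 2)) :=
        lintegral_mono_set (horoballBox_subset hm)
    _ ≤ hypVolume horoball := lintegral_le_hypVolume _

theorem hypVolume_horoball : hypVolume horoball = ⊤ := by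
  refine ENNReal.eq_top_of_forall_nnreal_le fun r => ?_
  refine le_trans ?_ (le_hypVolume_horoball (m := 1 + 3 * r) (by simp))
  rw [← ENNReal.ofReal_coe_nnreal]
  apply ENNReal.ofReal_le_ofReal
  nlinarith [sq_nonneg (r : ℝ), r.coe_nonneg]

theorem hypVolume_cell_faceNormals {n : ℕ} [Fact (5 ≤ n)] (hA : 1 ≤ normA n) :
    hypVolume (cell (faceNormals n)) = ⊤ :=
  measure_mono_top (horoball_subset_cell hA) hypVolume_horoball

end Volume

end Hyp3

end

theorem mainTheorem9 (n : ℕ) (hn : 6 ≤ n) :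
    ∃ C : Set Hyp3.H3,
      Hyp3.IsConvexPolyhedron C ∧
      Hyp3.hypVolume C = ⊤ ∧
      (∃ F, Hyp3.IsFace 2 C F) ∧
      (∀ F, Hyp3.IsFace 2 C F → Hyp3.IsRegularRightAngledPolygon n F) ∧
      (∀ F G u v, Hyp3.IsFaceWithNormal 2 C F u → Hyp3.IsFaceWithNormal 2 C G v →
        F ≠ G → (F ∩ G).Nonempty →
          Hyp3.IsFace 1 F (F ∩ G) ∧ Hyp3.IsFace 1 G (F ∩ G) ∧
          Hyp3.dihedralAngle u v = Real.pi / 2) ∧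
      (∀ p : Hyp3.H3, Hyp3.IsFace 0 C {p} →
        {F | Hyp3.IsFace 2 C F ∧ p ∈ F}.ncard = 3 ∧
        {E | Hyp3.IsFace 1 C E ∧ p ∈ E}.ncard = 3) := by
  have : Fact (5 ≤ n) := ⟨by omega⟩
  have hO := Hyp3.rightAngled_faceNormals n
  refine ⟨Hyp3.cell (Hyp3.faceNormals n), hO.isConvexPolyhedron_cell,
    Hyp3.hypVolume_cell_faceNormals (Hyp3.one_le_normA hn),
    ⟨_, hO.isFace_two (Hyp3.faceNormal_mem_faceNormals n) ?_⟩, ?_, ?_,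
    fun p hp => ⟨hO.ncard_setOf_isFace (by norm_num) hp, hO.ncard_setOf_isFace (by norm_num) hp⟩⟩
  · exact Hyp3.cell_inter_plane_faceNormal n ▸ ⟨_, Hyp3.vertex_mem_polygon n 0⟩
  · rintro F ⟨u, hu⟩
    exact hu.2.1 ▸ Hyp3.isRegularRightAngledPolygon_cell_inter_plane n (hO.normal_mem hu)
  · rintro F G u v hF hG hne ⟨x, hxF, hxG⟩
    have hu := hO.normal_mem hF
    have hv := hO.normal_mem hG
    obtain ⟨-, rfl, -⟩ := hF
    obtain ⟨-, rfl, -⟩ := hG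
    have huv : u ≠ v := fun h => hne (h ▸ rfl)
    rw [← Set.inter_inter_distrib_left, ← Set.inter_assoc]
    refine ⟨hO.isFace_one_inter hu hv huv ⟨x, hxF, hxG.2⟩, ?_, ?_⟩
    · rw [Set.inter_right_comm]
      exact hO.isFace_one_inter hv hu huv.symm ⟨x, hxG, hxF.2⟩
    · rw [Hyp3.dihedralAngle, hO.lor_eq_zero_of_mem_plane hu hv huv hxF.2 hxG.2,
        Real.arccos_zero, sub_half]
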